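/- Fix an inverse temperature $\beta>0$ and finite-dimensional quantum systems $S$ and $C$ with Hamiltonians $H_S$ and $H_C$. For a Hamiltonian $H$ let $\tau_H=e^{-\beta H}/\mathrm{Tr}\,e^{-\beta H}$ be its thermal state; $n$ copies of $C$ carry the sum of the $n$ single-copy Hamiltonians. A thermal operation on a system $A$ with Hamiltonian $H_A$ is a map $\mathcal T[X]=\mathrm{Tr}_B\big[U(X\otimes\tau_{H_B})U^\dagger\big]$, where $B$ is a finite-dimensional bath with Hamiltonian $H_B$ and $U$ is a unitary on $AB$ with $[U,H_A\otimes 1+1\otimes H_B]=0$. Let $\|M\|_1=\max\{\mathrm{Tr}[PM] : 0\le P\le 1\}$ denote the trace distance (applied to a difference $M$ of two states). Theorem. Let $\rho_S,\sigma_S$ be any two states of $S$ that commute with $H_S$, and let $\omega_C$ be any state of $C$ that commutes with $H_C$ and is not a truncated thermal state, i.e. is not of the form $P\tau_{H_C}/\mathrm{Tr}[P\tau_{H_C}]$ with an orthogonal projection $P$ commuting with $H_C$ (in particular $\omega_C$ is neither thermal nor a pure energy eigenstate; every non-thermal state of full rank commuting with $H_C$ is allowed). Then there are constants $K_C,K_S$,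 independent of $n$, such that for every $n\ge 1$ there is a thermal operation $\mathcal T_{SC}$ on $S$ together with $n$ copies of $C$ for which the output $\sigma'_{SC}=\mathcal T_{SC}[\rho_S\otimes\omega_C^{\otimes n}]$ satisfies $$\big\|\mathrm{Tr}_S[\sigma'_{SC}]-\omega_C^{\otimes n}\big\|_1\le \frac{K_C}{\sqrt n},\qquad \big\|\mathrm{Tr}_C[\sigma'_{SC}]-\sigma_S\big\|_1\le\frac{K_S}{n}.$$ -/

import Mathlib

open Matrix
open scoped Kronecker ComplexOrder

namespace ThermoCat

/-- A quantum state (density matrix): positive semidefinite with unit trace. -/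
def IsState {A : Type*} [Fintype A] (M : Matrix A A ℂ) : Prop :=
  M.PosSemidef ∧ M.trace = 1

/-- The thermal state `exp (-β H) / Tr exp (-β H)`. -/
noncomputable def thermalState {A : Type*} [Fintype A] [DecidableEq A] (β : ℝ)
    (H : Matrix A A ℂ) : Matrix A A ℂ :=
  (NormedSpace.exp (-((β : ℂ) • H))).trace⁻¹ • NormedSpace.exp (-((β : ℂ) • H))

/-- The Hamiltonian `H ⊗ 1 + 1 ⊗ K` of two non-interacting systems. -/
def sumHam {A B : Type*} [DecidableEq A] [DecidableEq B]
    (H : Matrix A A ℂ) (K : Matrix B B ℂ) : Matrix (A × B) (A × B) ℂ :=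
  H ⊗ₖ (1 : Matrix B B ℂ) + (1 : Matrix A A ℂ) ⊗ₖ K

/-- The `n`-fold tensor power of a matrix; the basis of the `n`-fold tensor power of
`A → ℂ` is indexed by `Fin n → A`. -/
def tensorPow {A : Type*} (n : ℕ) (M : Matrix A A ℂ) :
    Matrix (Fin n → A) (Fin n → A) ℂ :=
  Matrix.of fun x y => ∏ i, M (x i) (y i)

/-- The Hamiltonian of `n` non-interacting copies: the sum over `i` of the operator that acts as
`H` on the `i`-th tensor factor and as the identity on the others. -/
def copiesHam {A : Type*} [DecidableEq A] (n : ℕ) (H : Matrix A A ℂ) :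
    Matrix (Fin n → A) (Fin n → A) ℂ :=
  ∑ i, Matrix.of fun x y => if ∀ j, j ≠ i → x j = y j then H (x i) (y i) else 0

/-- Partial trace over the second tensor factor. -/
def traceSnd {A B : Type*} [Fintype B] (M : Matrix (A × B) (A × B) ℂ) : Matrix A A ℂ :=
  Matrix.of fun i j => ∑ k, M (i, k) (j, k)

/-- Partial trace over the first tensor factor. -/
def traceFst {A B : Type*} [Fintype A] (M : Matrix (A × B) (A × B) ℂ) : Matrix B B ℂ :=
  Matrix.of fun i j => ∑ k, M (k, i) (k, j)

/-- Trace distance `max {Tr[P (M - N)] | 0 ≤ P ≤ 1}` of two states; equivalently, half of the sum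
of the absolute values of the eigenvalues of `M - N`. -/
noncomputable def traceDist {A : Type*} [Fintype A] [DecidableEq A] (M N : Matrix A A ℂ) : ℝ :=
  sSup {x : ℝ | ∃ P : Matrix A A ℂ,
    P.PosSemidef ∧ (1 - P).PosSemidef ∧ x = (P * (M - N)).trace.re}

/-- Thermal operations on a system with Hamiltonian `H` at inverse temperature `β`: couple the
system to a finite-dimensional bath in its thermal state, apply a unitary that conserves the total
energy, and discard the bath. -/
def IsThermalOperation {A : Type*} [Fintype A] [DecidableEq A] (β : ℝ) (H : Matrix A A ℂ)
    (T : Matrix A A ℂ → Matrix A A ℂ) : Prop :=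
  ∃ (d : ℕ) (HB : Matrix (Fin d) (Fin d) ℂ) (U : Matrix (A × Fin d) (A × Fin d) ℂ),
    0 < d ∧ HB.IsHermitian ∧ U ∈ Matrix.unitaryGroup (A × Fin d) ℂ ∧
    Commute U (sumHam H HB) ∧
    ∀ X : Matrix A A ℂ, T X = traceSnd (U * (X ⊗ₖ thermalState β HB) * Uᴴ)

/-- `ω` is a truncated thermal state `P τ / Tr[P τ]`, where `τ` is the thermal state and `P` is
an orthogonal projection that commutes with the Hamiltonian. This covers the thermal state itself
(`P = 1`) and the pure energy eigenstates (`P` of rank one). -/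
def IsTruncatedThermal {A : Type*} [Fintype A] [DecidableEq A] (β : ℝ)
    (H ω : Matrix A A ℂ) : Prop :=
  ∃ P : Matrix A A ℂ, P.IsHermitian ∧ P * P = P ∧ Commute P H ∧
    ω = (P * thermalState β H).trace⁻¹ • (P * thermalState β H)

end ThermoCat

namespace ThermoCat

/-! All states involved are diagonal in energy eigenbases, so the problem is classical: populations
are moved by a kernel `G` that is substochastic and under which the Gibbs weights are subinvariant.
Only lower bounds on the output are needed, since for normalised populations the one-sided deficit
already bounds the trace distance. Two constructions carry the proof.

The kernel (`exists_catalytic_kernel`). As `ω` is not truncated thermal, it has two populated levels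
`i`, `j` with θ = h_i q_j / (h_j q_i) < 1, where `h` are the Gibbs weights and `q` the populations
(`exists_athermal_pair`). Cut the `n` copies into N = n / m blocks of fixed length `m`, choose a
block that is constantly `i`, make it constantly `j`, and replace the state of `S` by `σ`. One flip
buys a Gibbs factor of order θ^m, so a fixed large `m` pays for any preparation of `S`. The i.i.d.
law hardly notices: the numbers of constant blocks have means N q_i^m and N q_j^m and fluctuations
of order √N, so moving one block changes likelihoods by a relative O(1/√N), while by Chebyshev the
flip fails only with probability O(1/N). These are the two rates of the theorem.

The bath (`exists_conserving_perm`). Its levels are occupation vectors k in a box, with energy ∑ k_c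
E_c and degeneracy about R exp(β ∑ k_c E_c). A joint level (a, k) has total occupation k + e_a, and
keeping it fixed conserves energy without any commensurability of the spectrum. In the shell of
total occupation κ the number of states with system level `a` is nearly proportional to exp(-β E_a),
so Gibbs subinvariance of `G` is exactly the capacity condition of a transport problem, which a
permutation solves. Bath populations are almost flat over the box, hence boundary and rounding cost
an arbitrarily small ε. -/

/-! ### Permutations realising integer transport plans -/

theorem exists_perm_extending {I α : Type*} [Finite α] (f g : I ↪ α) :
    ∃ π : Equiv.Perm α, ∀ i, π (f i) = g i := by
  classical
  let e : {x // x ∈ Set.range f} ≃ {x // x ∈ Set.range g} :=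
    (Equiv.ofInjective f f.injective).symm.trans (Equiv.ofInjective g g.injective)
  refine ⟨e.extendSubtype, fun i => ?_⟩
  rw [e.extendSubtype_apply_of_mem (f i) ⟨i, rfl⟩]
  have : (⟨f i, ⟨i, rfl⟩⟩ : {x // x ∈ Set.range f}) = Equiv.ofInjective f f.injective i := rfl
  rw [this]
  simp [e]

/-- Integer transport plans between the blocks of a finite set are realised by permutations. -/
theorem exists_perm_transport {α A : Type*} [Fintype α] [Fintype A] [DecidableEq A]
    (blk : α → A) (n : A → A → ℕ)
    (hr : ∀ a, ∑ a', n a a' ≤ Fintype.card {x // blk x = a})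
    (hc : ∀ a', ∑ a, n a a' ≤ Fintype.card {x // blk x = a'}) :
    ∃ π : Equiv.Perm α, ∀ a a', n a a' ≤ Fintype.card {x // blk x = a ∧ blk (π x) = a'} := by
  have h1 : ∀ a, Nonempty ((Σ a', Fin (n a a')) ↪ {x // blk x = a}) := fun a =>
    Function.Embedding.nonempty_of_card_le (by simpa using hr a)
  have h2 : ∀ a', Nonempty ((Σ a, Fin (n a a')) ↪ {x // blk x = a'}) := fun a' =>
    Function.Embedding.nonempty_of_card_le (by simpa using hc a')
  have f := fun a => (h1 a).some
  have g := fun a => (h2 a).some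
  let f' : (Σ a a', Fin (n a a')) ↪ α := ⟨fun p => f p.1 p.2, by
    rintro ⟨a, p⟩ ⟨b, q⟩ h
    have ha : a = b := by
      rw [← (f a p).2, ← (f b q).2]; exact congrArg blk h
    subst ha
    have : p = q := (f a).injective (Subtype.ext h)
    rw [this]⟩
  let g' : (Σ a a', Fin (n a a')) ↪ α := ⟨fun p => g p.2.1 ⟨p.1, p.2.2⟩, by
    rintro ⟨a, a', t⟩ ⟨b, b', s⟩ h
    have ha : a' = b' := by
      rw [← (g a' ⟨a, t⟩).2, ← (g b' ⟨b, s⟩).2]; exact congrArg blk h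
    subst ha
    have := (g a').injective (Subtype.ext h)
    simp only [Sigma.mk.injEq] at this
    obtain ⟨hab, hts⟩ := this
    subst hab
    rw [eq_of_heq hts]⟩
  obtain ⟨π, hπ⟩ := exists_perm_extending f' g'
  refine ⟨π, fun a a' => ?_⟩
  have := Fintype.card_le_of_injective
    (fun t : Fin (n a a') => (⟨f' ⟨a, a', t⟩, (f a ⟨a', t⟩).2, by
      rw [hπ]; exact (g a' ⟨a, t⟩).2⟩ : {x // blk x = a ∧ blk (π x) = a'}))
    (fun t s h => by simpa using h)
  simpa using this

/-- The transport problem decouples over the fibres of `lab`, and the fibrewise permutations glue.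
The label will be the conserved total occupation. -/
theorem exists_labelled_perm_transport {α A K : Type*} [Fintype α] [Fintype A] [DecidableEq A]
    [DecidableEq K] (lab : α → K) (blk : α → A) (n : K → A → A → ℕ)
    (hr : ∀ k a, ∑ a', n k a a' ≤ Fintype.card {x // lab x = k ∧ blk x = a})
    (hc : ∀ k a', ∑ a, n k a a' ≤ Fintype.card {x // lab x = k ∧ blk x = a'}) :
    ∃ π : Equiv.Perm α, (∀ x, lab (π x) = lab x) ∧
      ∀ k a a', n k a a' ≤ Fintype.card {x // lab x = k ∧ blk x = a ∧ blk (π x) = a'} := by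
  have key : ∀ k, ∃ π : Equiv.Perm {x // lab x = k},
      ∀ a a', n k a a' ≤ Fintype.card {x : {x // lab x = k} // blk x = a ∧ blk (π x) = a'} := by
    intro k
    apply exists_perm_transport (fun x : {x // lab x = k} => blk x)
    · intro a
      rw [Fintype.card_congr (Equiv.subtypeSubtypeEquivSubtypeInter (fun x => lab x = k)
        (fun x => blk x = a))]
      exact hr k a
    · intro a
      rw [Fintype.card_congr (Equiv.subtypeSubtypeEquivSubtypeInter (fun x => lab x = k)
        (fun x => blk x = a))]
      exact hc k a
  choose ϖ hϖ using key
  let e := Equiv.sigmaFiberEquiv lab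
  let π : Equiv.Perm α := e.symm.trans ((Equiv.sigmaCongrRight ϖ).trans e)
  have hπ : ∀ k (x : {x // lab x = k}), π x = ϖ k x := by
    rintro k ⟨x, rfl⟩
    rfl
  refine ⟨π, fun x => ?_, fun k a a' => (hϖ k a a').trans ?_⟩
  · rw [hπ (lab x) ⟨x, rfl⟩]; exact (ϖ (lab x) ⟨x, rfl⟩).2
  · refine Fintype.card_le_of_injective
      (fun x => ⟨x.1.1, x.1.2, x.2.1, by rw [hπ k x.1]; exact x.2.2⟩) ?_
    intro x y h
    exact Subtype.ext (Subtype.ext (by simpa using h))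

/-! ### The bath of occupation numbers -/

/-- The shell label of the system level `a` next to the reservoir level `k`. -/
def shellLabel {A : Type*} [DecidableEq A] {L : ℕ} (k : A → Fin L) (a : A) : A → ℕ :=
  fun c => (k c : ℕ) + if c = a then 1 else 0

theorem shellLabel_injective {A : Type*} [DecidableEq A] {L : ℕ} {k k' : A → Fin L} {a : A}
    (h : shellLabel k a = shellLabel k' a) : k = k' := by
  funext c
  have := congrFun h c
  simp only [shellLabel] at this
  exact Fin.ext (by omega)

/-- Total energy is a function of the shell label, so a permutation that keeps labels conserves
energy. -/
theorem sum_shellLabel_mul {A : Type*} [Fintype A] [DecidableEq A] {L : ℕ} (k : A → Fin L) (a : A)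
    (E : A → ℝ) : ∑ c, (shellLabel k a c : ℝ) * E c = E a + ∑ c, (k c : ℝ) * E c := by
  simp [shellLabel, add_mul, Finset.sum_add_distrib, add_comm]

theorem card_shell {A : Type*} [Fintype A] [DecidableEq A] {L : ℕ} (D : (A → Fin L) → ℕ)
    (k : A → Fin L) (a : A) :
    Fintype.card {x : A × (Σ k, Fin (D k)) // shellLabel x.2.1 x.1 = shellLabel k a ∧ x.1 = a}
      = D k := by
  have : Function.Bijective (fun d : Fin (D k) =>
      (⟨(a, ⟨k, d⟩), rfl, rfl⟩ :
        {x : A × (Σ k, Fin (D k)) // shellLabel x.2.1 x.1 = shellLabel k a ∧ x.1 = a})) := by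
    constructor
    · intro d d' h
      simpa using h
    · rintro ⟨⟨b, k', d⟩, h, rfl⟩
      obtain rfl := shellLabel_injective h
      exact ⟨d, rfl⟩
  rw [← Fintype.card_of_bijective this, Fintype.card_fin]

/-- Inside a shell, the block of `a` has size R exp(β(κ·E - E_a)) up to rounding. Sending the
fraction `G a a'` of block `a` to block `a'` therefore meets the capacities by `hcol`, and rounding
the flows down keeps them feasible. -/
theorem exists_reservoir_perm {A : Type*} [Fintype A] [DecidableEq A] (β : ℝ) (E : A → ℝ)
    (G : A → A → ℝ) (hG : ∀ a a', 0 ≤ G a a') (hrow : ∀ a, ∑ a', G a a' ≤ 1)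
    (hcol : ∀ a', ∑ a, Real.exp (-(β * E a)) * G a a' ≤ Real.exp (-(β * E a')))
    (M : ℕ) (R : ℝ) (hR : 0 ≤ R) (D : (A → Fin (M + 2)) → ℕ)
    (hD : ∀ k, D k = ⌊R * Real.exp (β * ∑ c, (k c : ℝ) * E c)⌋₊) :
    ∃ π : Equiv.Perm (A × (Σ k, Fin (D k))),
      (∀ x, shellLabel (π x).2.1 (π x).1 = shellLabel x.2.1 x.1) ∧
      ∀ k : A → Fin (M + 2), (∀ c, 1 ≤ (k c : ℕ) ∧ (k c : ℕ) ≤ M) → ∀ a a',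
        ⌊G a a' * D k⌋₊ ≤ Fintype.card {d : Fin (D k) // (π (a, ⟨k, d⟩)).1 = a'} := by
  classical
  let N : (A → ℕ) → A → ℕ := fun κ a =>
    Fintype.card {x : A × (Σ k, Fin (D k)) // shellLabel x.2.1 x.1 = κ ∧ x.1 = a}
  have hN : ∀ κ a, (N κ a : ℝ) ≤ R * Real.exp (β * ((∑ c, (κ c : ℝ) * E c) - E a)) := by
    intro κ a
    by_cases h : ∃ k : A → Fin (M + 2), κ = shellLabel k a
    · obtain ⟨k, rfl⟩ := h
      have : N (shellLabel k a) a = D k := card_shell D k a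
      rw [this, hD, sum_shellLabel_mul, add_sub_cancel_left]
      exact Nat.floor_le (by positivity)
    · have : N κ a = 0 := by
        refine Fintype.card_eq_zero_iff.2 ⟨?_⟩
        rintro ⟨⟨b, k', d⟩, h', rfl⟩
        exact h ⟨k', h'.symm⟩
      rw [this]
      simpa using by positivity
  -- At the edge of the box the target block may be absent from the shell; nothing is then sent
  -- there.
  let n : (A → ℕ) → A → A → ℕ := fun κ a a' =>
    if ∃ k : A → Fin (M + 2), κ = shellLabel k a' then ⌊G a a' * N κ a⌋₊ else 0
  have hn : ∀ κ a a', (n κ a a' : ℝ) ≤ G a a' * N κ a := by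
    intro κ a a'
    have h0 : 0 ≤ G a a' * N κ a := mul_nonneg (hG _ _) (Nat.cast_nonneg _)
    simp only [n]
    split_ifs
    · exact Nat.floor_le h0
    · simpa using h0
  obtain ⟨π, hπ, hc⟩ := exists_labelled_perm_transport
    (fun x : A × (Σ k, Fin (D k)) => shellLabel x.2.1 x.1) (fun x => x.1) n
    (by
      intro κ a
      have : (∑ a', n κ a a' : ℕ) ≤ (N κ a : ℝ) := by
        push_cast
        calc ∑ a', (n κ a a' : ℝ) ≤ ∑ a', G a a' * N κ a := Finset.sum_le_sum fun a' _ => hn _ _ _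
          _ = (∑ a', G a a') * N κ a := by rw [Finset.sum_mul]
          _ ≤ 1 * N κ a := by gcongr; exact hrow a
          _ = _ := one_mul _
      exact_mod_cast this)
    (by
      intro κ a'
      by_cases h : ∃ k : A → Fin (M + 2), κ = shellLabel k a'
      · obtain ⟨k, rfl⟩ := h
        rw [card_shell, hD]
        -- The capacity is itself a floor, but the flow is an integer, so the unrounded inequality
        -- suffices.
        refine Nat.le_floor ?_
        push_cast
        set κ := shellLabel k a' with hκ
        have h2 : ∀ a, (n κ a a' : ℝ) ≤
            R * Real.exp (β * ∑ c, (κ c : ℝ) * E c) * (Real.exp (-(β * E a)) * G a a') := by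
          intro a
          refine (hn _ _ _).trans ?_
          calc G a a' * N κ a ≤ G a a' * (R * Real.exp (β * ((∑ c, (κ c : ℝ) * E c) - E a))) := by
                gcongr; exacts [hG _ _, hN _ _]
            _ = _ := by
                rw [mul_sub, sub_eq_add_neg, Real.exp_add]; ring
        calc ∑ a, (n κ a a' : ℝ) ≤ _ := Finset.sum_le_sum fun a _ => h2 a
          _ = R * Real.exp (β * ∑ c, (κ c : ℝ) * E c) *
              ∑ a, (Real.exp (-(β * E a)) * G a a') := (Finset.mul_sum _ _ _).symm
          _ ≤ R * Real.exp (β * ∑ c, (κ c : ℝ) * E c) * Real.exp (-(β * E a')) := by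
                gcongr; exact hcol a'
          _ = _ := by
                rw [hκ, sum_shellLabel_mul, mul_assoc, ← Real.exp_add]; congr 2; ring
      · have : ∀ a, n κ a a' = 0 := fun a => if_neg h
        simp [this])
  refine ⟨π, hπ, fun k hk a a' => ?_⟩
  have hex : ∃ k' : A → Fin (M + 2), shellLabel k a = shellLabel k' a' := by
    -- The bath level k + e_a - e_a'; one unit of room on each side of 1..M keeps it in `Fin (M +
    -- 2)`.
    refine ⟨fun c => ⟨k c + (if c = a then 1 else 0) - (if c = a' then 1 else 0), ?_⟩, ?_⟩
    · have := hk c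
      split_ifs <;> omega
    · funext c
      have := hk c
      simp only [shellLabel]
      split_ifs <;> omega
  have h1 := hc (shellLabel k a) a a'
  have h2 : n (shellLabel k a) a a' = ⌊G a a' * D k⌋₊ := by
    have : N (shellLabel k a) a = D k := card_shell D k a
    simp only [n]
    rw [if_pos hex, this]
  rw [h2] at h1
  refine h1.trans (Fintype.card_le_of_surjective
    (fun d => ⟨(a, ⟨k, d.1⟩), rfl, rfl, d.2⟩) ?_)
  rintro ⟨⟨b, k', d⟩, h, rfl, h''⟩
  obtain rfl := shellLabel_injective h
  exact ⟨⟨d, h''⟩, rfl⟩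

/-- Each bath level carries total Gibbs weight between `R - w k` and `R`, so its populations are
nearly uniform over the box. Losses come only from the edge, small for large `M`, and from the
floors, small for large `R`. -/
theorem exists_conserving_perm {A : Type*} [Fintype A] [DecidableEq A] (β : ℝ) (E : A → ℝ)
    (G : A → A → ℝ) (hG : ∀ a a', 0 ≤ G a a') (hrow : ∀ a, ∑ a', G a a' ≤ 1)
    (hcol : ∀ a', ∑ a, Real.exp (-(β * E a)) * G a a' ≤ Real.exp (-(β * E a')))
    (ε : ℝ) (hε : 0 < ε) :
    ∃ (d : ℕ) (F : Fin d → ℝ) (π : Equiv.Perm (A × Fin d)), 0 < d ∧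
      (∀ x, E (π x).1 + F (π x).2 = E x.1 + F x.2) ∧
      ∀ a a', G a a' - ε ≤ ∑ b, Real.exp (-(β * F b)) / (∑ b', Real.exp (-(β * F b'))) *
        (if (π (a, b)).1 = a' then 1 else 0) := by
  classical
  have hG1 : ∀ a a', G a a' ≤ 1 := fun a a' =>
    (Finset.single_le_sum (f := fun a' => G a a') (fun i _ => hG a i) (Finset.mem_univ a')).trans
      (hrow a)
  -- The proportion of bath levels lying in the interior of the box.
  obtain ⟨M, hM⟩ : ∃ M : ℕ, 1 - ε / 2 < ((M : ℝ) / (M + 2)) ^ Fintype.card A := by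
    have h1 : Filter.Tendsto (fun M : ℕ => (M : ℝ) / (M + 2)) Filter.atTop (nhds 1) := by
      simpa using tendsto_natCast_div_add_atTop (𝕜 := ℝ) 2
    have h2 := (h1.pow (Fintype.card A)).eventually (lt_mem_nhds (a := 1 - ε / 2) (by simpa using hε))
    exact h2.exists
  let f : (A → Fin (M + 2)) → ℝ := fun k => ∑ c, (k c : ℝ) * E c
  let w : (A → Fin (M + 2)) → ℝ := fun k => Real.exp (-(β * f k))
  have hw : ∀ k, 0 < w k := fun k => Real.exp_pos _
  let W := ∑ k, w k
  have hW : 0 < W := Finset.sum_pos (fun k _ => hw k) Finset.univ_nonempty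
  let V : ℝ := ((M : ℝ) + 2) ^ Fintype.card A
  have hV : 0 < V := by positivity
  -- The first bound makes the bath nonempty (level 0 has degeneracy at least 1); the second
  -- controls the rounding losses, at most `2 * w k` per level.
  obtain ⟨R, hRW, hR⟩ : ∃ R : ℝ, W ≤ R ∧ 2 * W / (R * V) ≤ ε / 2 := by
    refine ⟨W + 4 * W / (ε * V), by have : 0 ≤ 4 * W / (ε * V) := by positivity
                                    linarith, ?_⟩
    rw [div_le_iff₀ (by positivity)]
    have : ε / 2 * ((W + 4 * W / (ε * V)) * V) = ε / 2 * W * V + 2 * W := by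
      field_simp; ring
    rw [this]
    have : 0 < ε / 2 * W * V := by positivity
    linarith
  have hR0 : 0 < R := hW.trans_le hRW
  let D : (A → Fin (M + 2)) → ℕ := fun k => ⌊R * Real.exp (β * f k)⌋₊
  have hwexp : ∀ k, w k * Real.exp (β * f k) = 1 := fun k => by
    rw [← Real.exp_add]; simp
  have hD1 : ∀ k, w k * D k ≤ R := fun k => by
    have : (D k : ℝ) ≤ R * Real.exp (β * f k) := Nat.floor_le (by positivity)
    calc w k * D k ≤ w k * (R * Real.exp (β * f k)) := by gcongr
      _ = R := by rw [mul_left_comm, hwexp, mul_one]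
  have hD2 : ∀ k, R - w k ≤ w k * D k := fun k => by
    have : R * Real.exp (β * f k) ≤ D k + 1 := (Nat.lt_floor_add_one _).le
    have := mul_le_mul_of_nonneg_left this (hw k).le
    rw [mul_left_comm, hwexp] at this
    linarith
  obtain ⟨π, hπ, hcount⟩ := exists_reservoir_perm β E G hG hrow hcol M R hR0.le D (fun k => rfl)
  let B := Σ k, Fin (D k)
  have hBne : Nonempty B := by
    let k0 : A → Fin (M + 2) := fun _ => 0
    have h : w k0 = 1 := by simp [w, f, k0]
    have : 1 ≤ D k0 := by
      refine Nat.le_floor ?_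
      have h1 : w k0 ≤ W := Finset.single_le_sum (fun k _ => (hw k).le) (Finset.mem_univ k0)
      have h2 := hwexp k0
      rw [h, one_mul] at h2
      rw [h2, Nat.cast_one, mul_one]
      linarith
    exact ⟨⟨k0, ⟨0, this⟩⟩⟩
  let e : B ≃ Fin (Fintype.card B) := Fintype.equivFin B
  let F : B → ℝ := fun b => f b.1
  let Z := ∑ b : B, Real.exp (-(β * F b))
  have hZpos : 0 < Z := Finset.sum_pos (fun b _ => Real.exp_pos _) Finset.univ_nonempty
  have hZ : Z ≤ R * V := by
    have : Z = ∑ k, w k * D k := by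
      simp only [Z, F]
      rw [Fintype.sum_sigma]
      simp [w, mul_comm]
    rw [this]
    calc ∑ k, w k * D k ≤ ∑ k : A → Fin (M + 2), R := Finset.sum_le_sum fun k _ => hD1 k
      _ = R * V := by simp [V, mul_comm]
  have main : ∀ a a', (G a a' - ε) * Z ≤
      ∑ b : B, Real.exp (-(β * F b)) * (if (π (a, b)).1 = a' then 1 else 0) := by
    intro a a'
    let T : (A → Fin (M + 2)) → ℝ := fun k =>
      w k * Fintype.card {d : Fin (D k) // (π (a, ⟨k, d⟩)).1 = a'}
    have hT0 : ∀ k, 0 ≤ T k := fun k => mul_nonneg (hw k).le (Nat.cast_nonneg _)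
    have hT : ∑ b : B, Real.exp (-(β * F b)) * (if (π (a, b)).1 = a' then 1 else 0)
        = ∑ k, T k := by
      rw [Fintype.sum_sigma]
      refine Finset.sum_congr rfl fun k _ => ?_
      simp only [T, F]
      rw [← Finset.mul_sum, Fintype.card_subtype]
      simp [w]
    rw [hT]
    let ι : (A → Fin M) → (A → Fin (M + 2)) := fun j c => (j c).castSucc.succ
    have hι : Function.Injective ι := by
      intro j j' h
      funext c
      simpa [ι] using congrFun h c
    have h1 : ∀ j, G a a' * R - 2 * w (ι j) ≤ T (ι j) := by
      intro j
      have h2 := hcount (ι j) (fun c => by simp [ι])  a a'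
      have h3 : G a a' * D (ι j) - 1 ≤ (⌊G a a' * D (ι j)⌋₊ : ℝ) :=
        (Nat.sub_one_lt_floor _).le
      have h4 : (⌊G a a' * D (ι j)⌋₊ : ℝ) ≤
        Fintype.card {d : Fin (D (ι j)) // (π (a, ⟨ι j, d⟩)).1 = a'} := by exact_mod_cast h2
      have h5 := mul_le_mul_of_nonneg_left (h3.trans h4) (hw (ι j)).le
      have h6 := mul_le_mul_of_nonneg_left (hD2 (ι j)) (hG a a')
      have h7 := mul_le_mul_of_nonneg_right (hG1 a a') (hw (ι j)).le
      simp only [T]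
      nlinarith
    have h8 : ∑ j, (G a a' * R - 2 * w (ι j)) ≤ ∑ k, T k := by
      refine (Finset.sum_le_sum fun j _ => h1 j).trans ?_
      rw [← Finset.sum_image (f := T) (s := Finset.univ) (g := ι) (fun x _ y _ h => hι h)]
      exact Finset.sum_le_sum_of_subset_of_nonneg (Finset.subset_univ _) fun k _ _ => hT0 k
    have h9 : ∑ j, w (ι j) ≤ W := by
      rw [← Finset.sum_image (f := w) (s := Finset.univ) (g := ι) (fun x _ y _ h => hι h)]
      exact Finset.sum_le_sum_of_subset_of_nonneg (Finset.subset_univ _) fun k _ _ => (hw k).le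
    have h10 : (G a a' * R) * (M : ℝ) ^ Fintype.card A - 2 * W ≤ ∑ k, T k := by
      refine le_trans ?_ h8
      rw [Finset.sum_sub_distrib, ← Finset.mul_sum (f := fun j => w (ι j))]
      have : (Fintype.card (A → Fin M) : ℝ) = (M : ℝ) ^ Fintype.card A := by simp
      rw [Finset.sum_const, Finset.card_univ, nsmul_eq_mul, this]
      linarith
    -- Replacing `Z` by its upper bound `R * V` is legitimate only when the left factor is
    -- nonnegative.
    by_cases hneg : G a a' - ε ≤ 0
    · exact (mul_nonpos_of_nonpos_of_nonneg hneg hZpos.le).trans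
        (Finset.sum_nonneg fun k _ => hT0 k)
    push Not at hneg
    refine (mul_le_mul_of_nonneg_left hZ hneg.le).trans (le_trans ?_ h10)
    have h11 : (1 - ε / 2) * V ≤ (M : ℝ) ^ Fintype.card A := by
      rw [div_pow, lt_div_iff₀ (by positivity)] at hM
      exact hM.le
    have h12 : 2 * W ≤ ε / 2 * (R * V) := by
      rwa [div_le_iff₀ (by positivity)] at hR
    have h13 := mul_le_mul_of_nonneg_left h11 (mul_nonneg (hG a a') hR0.le)
    have h14 := mul_le_mul_of_nonneg_right (hG1 a a') (by positivity : 0 ≤ ε / 2 * (R * V))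
    nlinarith
  refine ⟨Fintype.card B, fun i => F (e.symm i),
    ((Equiv.refl A).prodCongr e).symm.trans (π.trans ((Equiv.refl A).prodCongr e)),
    Fintype.card_pos, ?_, ?_⟩
  · rintro ⟨a, i⟩
    have h := hπ (a, e.symm i)
    have h1 := sum_shellLabel_mul (π (a, e.symm i)).2.1 (π (a, e.symm i)).1 E
    have h2 := sum_shellLabel_mul (e.symm i).1 a E
    rw [h] at h1
    simp only at h1
    rw [h2] at h1
    simpa [F, f] using h1.symm
  · intro a a'
    have hm := main a a'
    rw [← le_div_iff₀ hZpos, Finset.sum_div] at hm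
    refine hm.trans (le_of_eq ?_)
    have hZ' : ∑ i, Real.exp (-(β * F (e.symm i))) = Z :=
      e.symm.sum_comp (fun b => Real.exp (-(β * F b)))
    rw [hZ', ← e.symm.sum_comp]
    refine Finset.sum_congr rfl fun i _ => ?_
    simp [ite_div]

/-! ### Flipping a constant block of an i.i.d. sequence -/

section Flip

set_option linter.unusedSectionVars false

variable {ι C : Type*} [Fintype ι] [DecidableEq ι] [Fintype C] [DecidableEq C]

/-- Indicator of the event that all positions in `s` carry the value `i`. -/
def blockInd (s : Finset ι) (i : C) (x : ι → C) : ℝ := if ∀ t ∈ s, x t = i then 1 else 0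

/-- Exchange the values `i` and `j` on the positions in `s`. -/
def blockSwap (i j : C) (s : Finset ι) (x : ι → C) : ι → C :=
  fun t => if t ∈ s then Equiv.swap i j (x t) else x t

theorem sum_prod_mul_blockInd (q : C → ℝ) (hq1 : ∑ c, q c = 1) (s : Finset ι) (i : C) :
    ∑ x : ι → C, (∏ t, q (x t)) * blockInd s i x = q i ^ s.card := by
  have h : ∀ x : ι → C, (∏ t, q (x t)) * blockInd s i x =
      ∏ t, (if t ∈ s then (if x t = i then q (x t) else 0) else q (x t)) := by
    intro x
    unfold blockInd
    split_ifs with h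
    · rw [mul_one]
      refine Finset.prod_congr rfl fun t _ => ?_
      split_ifs with h1 h2
      · rfl
      · exact absurd (h t h1) h2
      · rfl
    · push Not at h
      obtain ⟨t, ht, hx⟩ := h
      rw [mul_zero, eq_comm]
      exact Finset.prod_eq_zero (Finset.mem_univ t) (by simp [ht, hx])
  rw [Finset.sum_congr rfl fun x _ => h x]
  have := Finset.prod_univ_sum (fun _ : ι => (Finset.univ : Finset C))
    (fun t c => if t ∈ s then (if c = i then q c else 0) else q c)
  rw [Fintype.piFinset_univ] at this
  rw [← this]
  have h2 : ∀ t, ∑ c, (if t ∈ s then (if c = i then q c else 0) else q c)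
      = if t ∈ s then q i else 1 := by
    intro t
    split_ifs <;> simp [hq1]
  rw [Finset.prod_congr rfl fun t _ => h2 t, Finset.prod_ite]
  simp

theorem blockInd_sq (s : Finset ι) (i : C) (x : ι → C) :
    blockInd s i x * blockInd s i x = blockInd s i x := by
  unfold blockInd; split_ifs <;> simp

theorem blockInd_mul (s s' : Finset ι) (i : C) (x : ι → C) :
    blockInd s i x * blockInd s' i x = blockInd (s ∪ s') i x := by
  unfold blockInd
  simp only [Finset.mem_union, or_imp, forall_and]
  split_ifs <;> simp_all

theorem blockInd_nonneg (s : Finset ι) (i : C) (x : ι → C) : 0 ≤ blockInd s i x := by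
  unfold blockInd; split_ifs <;> simp

theorem blockSwap_involutive (i j : C) (s : Finset ι) (x : ι → C) :
    blockSwap i j s (blockSwap i j s x) = x := by
  funext t
  unfold blockSwap
  split_ifs <;> simp

theorem blockInd_blockSwap (i j : C) (s : Finset ι) (x : ι → C) :
    blockInd s i (blockSwap i j s x) = blockInd s j x := by
  unfold blockInd blockSwap
  congr 1
  refine propext (forall₂_congr fun t ht => ?_)
  rw [if_pos ht, Equiv.swap_apply_eq_iff, Equiv.swap_apply_left]

theorem blockInd_blockSwap_of_disjoint (i j c : C) {s s' : Finset ι} (h : Disjoint s s')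
    (x : ι → C) : blockInd s c (blockSwap i j s' x) = blockInd s c x := by
  unfold blockInd blockSwap
  congr 1
  refine propext (forall₂_congr fun t ht => ?_)
  rw [if_neg (Finset.disjoint_left.1 h ht)]

theorem blockInd_eq_zero_of_ne {s : Finset ι} (hs : s.Nonempty) {i j : C} (hij : i ≠ j) {x : ι → C}
    (h : blockInd s i x ≠ 0) : blockInd s j x = 0 := by
  unfold blockInd at *
  obtain ⟨t, ht⟩ := hs
  split_ifs at h with h1
  · rw [if_neg]
    intro h2
    exact hij ((h1 t ht).symm.trans (h2 t ht))
  · exact absurd rfl h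

theorem blockInd_eq_one {s : Finset ι} {i : C} {x : ι → C} (h : blockInd s i x ≠ 0) :
    blockInd s i x = 1 := by
  unfold blockInd at *
  split_ifs at * <;> simp_all

/-- Only the factors in `s` change, from `w j` to `w i`. The form without division needs no
nonvanishing weights. -/
theorem prod_blockSwap (w : C → ℝ) {i j : C} {s : Finset ι} {y : ι → C}
    (h : blockInd s j y ≠ 0) :
    (∏ t, w (blockSwap i j s y t)) * w j ^ s.card = (∏ t, w (y t)) * w i ^ s.card := by
  have h' : ∀ t ∈ s, y t = j := by
    unfold blockInd at h
    by_contra hc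
    exact h (if_neg hc)
  rw [← Finset.prod_mul_prod_compl s, ← Finset.prod_mul_prod_compl s (fun t => w (y t))]
  have h1 : ∏ t ∈ s, w (blockSwap i j s y t) = w i ^ s.card := by
    rw [Finset.prod_congr rfl (g := fun _ => w i), Finset.prod_const]
    intro t ht
    simp [blockSwap, ht, h' t ht]
  have h2 : ∏ t ∈ s, w (y t) = w j ^ s.card := by
    rw [Finset.prod_congr rfl (g := fun _ => w j), Finset.prod_const]
    intro t ht
    simp [h' t ht]
  have h3 : ∏ t ∈ sᶜ, w (blockSwap i j s y t) = ∏ t ∈ sᶜ, w (y t) := by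
    refine Finset.prod_congr rfl fun t ht => ?_
    simp [blockSwap, Finset.mem_compl.1 ht]
  rw [h1, h2, h3]
  ring

/-- Number of blocks on which `x` is constantly `i`. -/
def blockCount {N : ℕ} (blk : Fin N → Finset ι) (i : C) (x : ι → C) : ℝ :=
  ∑ b, blockInd (blk b) i x

theorem blockCount_nonneg {N : ℕ} (blk : Fin N → Finset ι) (i : C) (x : ι → C) :
    0 ≤ blockCount blk i x := Finset.sum_nonneg fun _ _ => blockInd_nonneg _ _ _

theorem blockCount_blockSwap {N : ℕ} {blk : Fin N → Finset ι}
    (hdisj : ∀ b b', b ≠ b' → Disjoint (blk b) (blk b')) (hne : ∀ b, (blk b).Nonempty)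
    {i j : C} (hij : i ≠ j) (b : Fin N) {y : ι → C} (h : blockInd (blk b) j y ≠ 0) :
    blockCount blk i (blockSwap i j (blk b) y) = blockCount blk i y + 1 ∧
    blockCount blk j (blockSwap i j (blk b) y) + 1 = blockCount blk j y := by
  have h1 := blockInd_eq_one h
  have h0 := blockInd_eq_zero_of_ne (hne b) hij.symm h
  have hr : ∀ c, ∑ b' ∈ Finset.univ.erase b, blockInd (blk b') c (blockSwap i j (blk b) y) =
      ∑ b' ∈ Finset.univ.erase b, blockInd (blk b') c y := fun c =>
    Finset.sum_congr rfl fun b' hb' =>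
      blockInd_blockSwap_of_disjoint _ _ _ (hdisj _ _ (Finset.ne_of_mem_erase hb')) _
  have hsj : blockInd (blk b) j (blockSwap i j (blk b) y) = blockInd (blk b) i y := by
    have := blockInd_blockSwap j i (blk b) y
    have hc : blockSwap j i (blk b) y = blockSwap i j (blk b) y := by
      unfold blockSwap; rw [Equiv.swap_comm]
    rwa [hc] at this
  unfold blockCount
  constructor
  · rw [← Finset.add_sum_erase _ _ (Finset.mem_univ b), hr, blockInd_blockSwap, h1,
      ← Finset.add_sum_erase _ (fun b' => blockInd (blk b') i y) (Finset.mem_univ b), h0]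
    ring
  · rw [← Finset.add_sum_erase _ _ (Finset.mem_univ b), hr, hsj, h0,
      ← Finset.add_sum_erase _ (fun b' => blockInd (blk b') j y) (Finset.mem_univ b), h1]
    ring

/-- Variance bound for the number of constant blocks under an i.i.d. distribution. -/
theorem sum_mul_sq_blockCount_le (q : C → ℝ) (hq1 : ∑ c, q c = 1) {N m : ℕ}
    {blk : Fin N → Finset ι} (hdisj : ∀ b b', b ≠ b' → Disjoint (blk b) (blk b'))
    (hcard : ∀ b, (blk b).card = m) (i : C) :
    ∑ x : ι → C, (∏ t, q (x t)) * (blockCount blk i x - N * q i ^ m) ^ 2 ≤ N := by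
  set a := q i ^ m with ha
  have hP : ∑ x : ι → C, (∏ t, q (x t)) = 1 := by
    have := sum_prod_mul_blockInd (ι := ι) q hq1 ∅ i
    simpa [blockInd] using this
  have hE : ∀ b, ∑ x : ι → C, (∏ t, q (x t)) * blockInd (blk b) i x = a := fun b => by
    rw [sum_prod_mul_blockInd q hq1, hcard]
  have hEE : ∀ b b', ∑ x : ι → C, (∏ t, q (x t)) *
      ((blockInd (blk b) i x - a) * (blockInd (blk b') i x - a)) =
      if b = b' then a - a ^ 2 else 0 := by
    intro b b'
    have hexp : ∀ x : ι → C, (∏ t, q (x t)) *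
      ((blockInd (blk b) i x - a) * (blockInd (blk b') i x - a)) =
      (∏ t, q (x t)) * (blockInd (blk b) i x * blockInd (blk b') i x)
      - a * ((∏ t, q (x t)) * blockInd (blk b) i x) - a * ((∏ t, q (x t)) * blockInd (blk b') i x)
      + a ^ 2 * (∏ t, q (x t)) := fun x => by ring
    rw [Finset.sum_congr rfl fun x _ => hexp x, Finset.sum_add_distrib, Finset.sum_sub_distrib,
      Finset.sum_sub_distrib, ← Finset.mul_sum, ← Finset.mul_sum, ← Finset.mul_sum, hE, hE, hP]
    split_ifs with hb
    · subst hb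
      simp only [blockInd_sq]
      rw [hE]
      ring
    -- Disjoint blocks are independent, so covariances vanish and only the N diagonal terms survive.
    · simp only [blockInd_mul]
      rw [sum_prod_mul_blockInd q hq1, Finset.card_union_of_disjoint (hdisj _ _ hb), hcard, hcard,
        pow_add, ← ha]
      ring
  have hsq : ∀ x : ι → C, (∏ t, q (x t)) * (blockCount blk i x - N * a) ^ 2 =
      ∑ b, ∑ b', (∏ t, q (x t)) *
        ((blockInd (blk b) i x - a) * (blockInd (blk b') i x - a)) := by
    intro x
    have : blockCount blk i x - N * a = ∑ b, (blockInd (blk b) i x - a) := by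
      simp [blockCount]
    rw [this, sq, Finset.sum_mul_sum, Finset.mul_sum]
    exact Finset.sum_congr rfl fun b _ => Finset.mul_sum _ _ _
  rw [Finset.sum_congr rfl fun x _ => hsq x, Finset.sum_comm]
  have : ∀ b, ∑ x : ι → C, ∑ b', (∏ t, q (x t)) *
        ((blockInd (blk b) i x - a) * (blockInd (blk b') i x - a)) = a - a ^ 2 := by
    intro b
    rw [Finset.sum_comm, Finset.sum_congr rfl fun b' _ => hEE b b']
    simp
  rw [Finset.sum_congr rfl fun b _ => this b]
  simp only [Finset.sum_const, Finset.card_univ, Fintype.card_fin, nsmul_eq_mul]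
  have hle : a - a ^ 2 ≤ 1 := by nlinarith [sq_nonneg (a - 1), sq_nonneg a]
  calc (N : ℝ) * (a - a ^ 2) ≤ N * 1 := by gcongr
    _ = N := mul_one _

/-- The stochastic kernel that picks a block on which the sequence is constantly `i` and turns it
into a block constantly `j`; the rate is truncated when `j` is over-represented. -/
noncomputable def flipKernel {N : ℕ} (blk : Fin N → Finset ι) (i j : C) (c : ℝ) (x y : ι → C) : ℝ :=
  ∑ b, if y = blockSwap i j (blk b) x then
    blockInd (blk b) i x / max (blockCount blk i x) (c * (blockCount blk j x + 1)) else 0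

theorem max_rate_pos {N : ℕ} (blk : Fin N → Finset ι) (i j : C) {c : ℝ} (hc : 0 < c) (x : ι → C) :
    0 < max (blockCount blk i x) (c * (blockCount blk j x + 1)) :=
  lt_max_of_lt_right (mul_pos hc (by linarith [blockCount_nonneg blk j x]))

theorem flipKernel_nonneg {N : ℕ} (blk : Fin N → Finset ι) (i j : C) {c : ℝ} (hc : 0 < c)
    (x y : ι → C) : 0 ≤ flipKernel blk i j c x y :=
  Finset.sum_nonneg fun b _ => by
    split_ifs
    · exact div_nonneg (blockInd_nonneg _ _ _) (max_rate_pos blk i j hc x).le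
    · exact le_rfl

theorem sum_flipKernel {N : ℕ} (blk : Fin N → Finset ι) (i j : C) (c : ℝ) (x : ι → C) :
    ∑ y, flipKernel blk i j c x y =
      blockCount blk i x / max (blockCount blk i x) (c * (blockCount blk j x + 1)) := by
  unfold flipKernel
  rw [Finset.sum_comm]
  simp only [Finset.sum_ite_eq', Finset.mem_univ, if_true]
  rw [← Finset.sum_div]
  rfl

theorem sum_flipKernel_le_one {N : ℕ} (blk : Fin N → Finset ι) (i j : C) {c : ℝ} (hc : 0 < c)
    (x : ι → C) : ∑ y, flipKernel blk i j c x y ≤ 1 := by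
  rw [sum_flipKernel, div_le_one (max_rate_pos blk i j hc x)]
  exact le_max_left _ _

/-- Action of the kernel on product weights. -/
theorem sum_prod_mul_flipKernel {N m : ℕ} {blk : Fin N → Finset ι}
    (hdisj : ∀ b b', b ≠ b' → Disjoint (blk b) (blk b')) (hcard : ∀ b, (blk b).card = m)
    (hm : 0 < m) {i j : C} (hij : i ≠ j) (c : ℝ) (w : C → ℝ) (hwj : w j ≠ 0) (y : ι → C) :
    ∑ x, (∏ t, w (x t)) * flipKernel blk i j c x y =
      (∏ t, w (y t)) * ((w i / w j) ^ m *
        (blockCount blk j y / max (blockCount blk i y + 1) (c * blockCount blk j y))) := by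
  have hne : ∀ b, (blk b).Nonempty := fun b => by
    rw [← Finset.card_pos, hcard]; exact hm
  unfold flipKernel
  simp only [Finset.mul_sum]
  rw [Finset.sum_comm]
  have : ∀ b, ∑ x : ι → C, (∏ t, w (x t)) * (if y = blockSwap i j (blk b) x then
      blockInd (blk b) i x / max (blockCount blk i x) (c * (blockCount blk j x + 1)) else 0) =
      blockInd (blk b) j y * ((∏ t, w (y t)) * ((w i / w j) ^ m /
        max (blockCount blk i y + 1) (c * blockCount blk j y))) := by
    intro b
    -- The swap is an involution, so for each block `y` has exactly one preimage; its count of `i`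
    -- is one higher and its count of `j` one lower.
    have hx : ∀ x, (y = blockSwap i j (blk b) x) ↔ x = blockSwap i j (blk b) y := by
      intro x
      constructor
      · rintro rfl; rw [blockSwap_involutive]
      · rintro rfl; rw [blockSwap_involutive]
    simp only [hx, mul_ite, mul_zero, Finset.sum_ite_eq', Finset.mem_univ, if_true]
    rw [blockInd_blockSwap]
    by_cases h : blockInd (blk b) j y = 0
    · simp [h]
    · obtain ⟨h1, h2⟩ := blockCount_blockSwap hdisj hne hij b h
      have h3 := prod_blockSwap w (i := i) h
      rw [hcard] at h3
      have h4 : ∏ t, w (blockSwap i j (blk b) y t) = (∏ t, w (y t)) * (w i / w j) ^ m := by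
        rw [div_pow, mul_div_assoc', eq_div_iff (pow_ne_zero _ hwj), h3]
      rw [h1, h2, h4]
      ring
  rw [Finset.sum_congr rfl fun b _ => this b, ← Finset.sum_mul]
  change blockCount blk j y * _ = _
  ring

end Flip

/-! ### Scalar estimates for the truncated rate -/

/-- The left side vanishes unless the truncation acts. Since `c * a'` is only half of `a`, that
forces a deviation of the counts of order `M * a / 2`, and a Chebyshev-type quadratic bound follows;
12 is 4 from the half times 3 from squaring three terms. -/
theorem one_sub_div_max_le {k l a a' c M : ℝ} (hk : 0 ≤ k) (hl : 0 ≤ l) (hc : 0 < c) (ha : 0 < a)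
    (hM : 0 < M) (hca : 2 * c * a' = a) :
    1 - k / max k (c * (l + 1)) ≤
      12 * ((k - M * a) ^ 2 + c ^ 2 * (l - M * a') ^ 2 + c ^ 2) / (M * a) ^ 2 := by
  have hpos : 0 < M * a := mul_pos hM ha
  rcases le_or_gt (c * (l + 1)) k with h | h
  · have hk : 0 < k := lt_of_lt_of_le (by positivity) h
    rw [max_eq_left h, div_self hk.ne', sub_self]
    positivity
  · have hmax : 0 < c * (l + 1) := by positivity
    rw [max_eq_right h.le]
    have h1 : 1 - k / (c * (l + 1)) ≤ 1 := by
      have : 0 ≤ k / (c * (l + 1)) := by positivity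
      linarith
    refine h1.trans ?_
    rw [le_div_iff₀ (by positivity), one_mul]
    set u := k - M * a with hu
    set v := l - M * a' with hv
    have h2 : M * a / 2 < -u + c * v + c := by
      have e1 : k = u + M * a := by rw [hu]; ring
      have e2 : l = v + M * a' := by rw [hv]; ring
      rw [e1, e2] at h
      have e3 : c * (M * a') = M * a / 2 := by rw [← hca]; ring
      nlinarith
    have h3 : (M * a / 2) ^ 2 ≤ (-u + c * v + c) ^ 2 := by
      gcongr
    nlinarith [sq_nonneg (u + c * v), sq_nonneg (u + c), sq_nonneg (c * v - c)]

/-- At the means `2 * c * l` equals `k`, so the likelihood ratio is close to 1 and its deficit is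
linear in the deviations. -/
theorem one_sub_div_max_le' {k l a a' c M : ℝ} (hk : 0 ≤ k) (hl : 0 ≤ l) (hc : 0 < c) (ha : 0 < a)
    (hM : 0 < M) (hca : 2 * c * a' = a) :
    max (1 - 2 * c * (l / max (k + 1) (c * l))) 0 ≤
      2 * (|k - M * a| + 2 * c * |l - M * a'| + 1) / (M * a) := by
  have hpos : 0 < M * a := mul_pos hM ha
  have hr : 0 ≤ 2 * (|k - M * a| + 2 * c * |l - M * a'| + 1) / (M * a) := by positivity
  refine max_le ?_ hr
  have hu := abs_le.1 (le_refl |k - M * a|)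
  have hv := abs_le.1 (le_refl |l - M * a'|)
  set u := |k - M * a|
  set v := |l - M * a'|
  have hcv : 2 * c * (M * a' - l) ≤ 2 * c * v := by gcongr; linarith
  have e3 : 2 * c * (M * a') = M * a := by rw [← hca]; ring
  rcases le_total (k + 1) (c * l) with h | h
  -- Under truncation the ratio is exactly 2, so there is no deficit.
  · have hl' : 0 < l := by
      by_contra hn
      have : l = 0 := le_antisymm (not_lt.1 hn) hl
      subst this
      linarith
    rw [max_eq_right h]
    have : 2 * c * (l / (c * l)) = 2 := by field_simp
    rw [this]
    linarith
  · rw [max_eq_left h]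
    rcases le_total (M * a / 2) (k + 1) with h1 | h1
    · have h2 : 1 - 2 * c * (l / (k + 1)) = (k + 1 - 2 * c * l) / (k + 1) := by
        field_simp
      have h3 : k + 1 - 2 * c * l ≤ u + 2 * c * v + 1 := by linarith
      have h4 : 0 ≤ u + 2 * c * v + 1 := by positivity
      rw [h2, div_le_div_iff₀ (by linarith) hpos]
      have h5 := mul_le_mul_of_nonneg_right h3 hpos.le
      have h6 := mul_le_mul_of_nonneg_left h1 h4
      linarith
    -- Here `k` is so far below its mean that the right side already exceeds 1.
    · have h2 : 0 ≤ 2 * c * (l / (k + 1)) := by positivity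
      have h3 : 1 ≤ 2 * (u + 2 * c * v + 1) / (M * a) := by
        rw [le_div_iff₀ hpos]
        have : 0 ≤ 2 * c * v := by positivity
        linarith
      linarith

/-! ### Failure probability and disturbance of the flip -/

section Deficit

set_option linter.unusedSectionVars false

variable {ι C : Type*} [Fintype ι] [DecidableEq ι] [Fintype C] [DecidableEq C]

theorem sum_prod_eq_one (q : C → ℝ) (hq1 : ∑ c, q c = 1) :
    ∑ x : ι → C, (∏ t, q (x t)) = 1 := by
  have : Nonempty C := by
    by_contra hne
    rw [not_nonempty_iff] at hne
    simp at hq1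
  simpa [blockInd] using sum_prod_mul_blockInd (ι := ι) q hq1 ∅ (Classical.arbitrary C)

end Deficit

section Deficit

variable {ι C : Type*} [Fintype ι] [DecidableEq ι] [Fintype C] [DecidableEq C]
  {q : C → ℝ} (hq : ∀ c, 0 ≤ q c) (hq1 : ∑ c, q c = 1) {N m : ℕ}
  {blk : Fin N → Finset ι} (hdisj : ∀ b b', b ≠ b' → Disjoint (blk b) (blk b'))
  (hcard : ∀ b, (blk b).card = m) {i j : C} (hi : 0 < q i) (hj : 0 < q j)

include hq hq1 in
theorem sum_mul_one_sub_flipKernel_le_one {c : ℝ} (hc : 0 < c) :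
    ∑ x : ι → C, (∏ t, q (x t)) * (1 - ∑ y, flipKernel blk i j c x y) ≤ 1 := by
  refine le_trans (Finset.sum_le_sum fun x _ => ?_) (sum_prod_eq_one (ι := ι) q hq1).le
  have h1 : 0 ≤ ∑ y, flipKernel blk i j c x y :=
    Finset.sum_nonneg fun y _ => flipKernel_nonneg blk i j hc x y
  have h2 : 0 ≤ ∏ t, q (x t) := Finset.prod_nonneg fun t _ => hq _
  nlinarith

include hq hq1 in
theorem sum_max_sub_flipKernel_le_one {c : ℝ} (hc : 0 < c) :
    ∑ y : ι → C, max ((∏ t, q (y t)) - ∑ x, (∏ t, q (x t)) * flipKernel blk i j c x y) 0 ≤ 1 := by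
  rw [← sum_prod_eq_one (ι := ι) q hq1]
  have h2 : ∀ x : ι → C, 0 ≤ ∏ t, q (x t) := fun x => Finset.prod_nonneg fun t _ => hq _
  refine Finset.sum_le_sum fun y _ => max_le ?_ (h2 y)
  have h1 : 0 ≤ ∑ x, (∏ t, q (x t)) * flipKernel blk i j c x y :=
    Finset.sum_nonneg fun x _ => mul_nonneg (h2 x) (flipKernel_nonneg blk i j hc x y)
  linarith

include hq hq1 hdisj hcard hi in
/-- The kernel stays put with probability `O(1/N)`. -/
theorem sum_mul_one_sub_flipKernel_le {c : ℝ} (hc : 0 < c) (hca : 2 * c * q j ^ m = q i ^ m)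
    (hN : 0 < N) :
    ∑ x : ι → C, (∏ t, q (x t)) * (1 - ∑ y, flipKernel blk i j c x y) ≤
      12 * (1 + 2 * c ^ 2) / (q i ^ m) ^ 2 / N := by
  have hN' : (0 : ℝ) < N := by exact_mod_cast hN
  have h2 : ∀ x : ι → C, 0 ≤ ∏ t, q (x t) := fun x => Finset.prod_nonneg fun t _ => hq _
  have ha : 0 < q i ^ m := pow_pos hi m
  have hu := sum_mul_sq_blockCount_le q hq1 hdisj hcard i
  have hv := sum_mul_sq_blockCount_le q hq1 hdisj hcard j
  have h1 := sum_prod_eq_one (ι := ι) q hq1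
  set a := q i ^ m
  set a' := q j ^ m
  calc ∑ x : ι → C, (∏ t, q (x t)) * (1 - ∑ y, flipKernel blk i j c x y)
      ≤ ∑ x : ι → C, (∏ t, q (x t)) * (12 * ((blockCount blk i x - N * a) ^ 2 +
          c ^ 2 * (blockCount blk j x - N * a') ^ 2 + c ^ 2) / (N * a) ^ 2) := by
        refine Finset.sum_le_sum fun x _ => mul_le_mul_of_nonneg_left ?_ (h2 x)
        rw [sum_flipKernel]
        exact one_sub_div_max_le (blockCount_nonneg _ _ _) (blockCount_nonneg _ _ _) hc ha hN' hca
    _ = 12 / (N * a) ^ 2 * ((∑ x : ι → C, (∏ t, q (x t)) * (blockCount blk i x - N * a) ^ 2) +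
          c ^ 2 * (∑ x : ι → C, (∏ t, q (x t)) * (blockCount blk j x - N * a') ^ 2) +
          c ^ 2 * ∑ x : ι → C, (∏ t, q (x t))) := by
        rw [Finset.mul_sum, Finset.mul_sum, ← Finset.sum_add_distrib, ← Finset.sum_add_distrib,
          Finset.mul_sum]
        refine Finset.sum_congr rfl fun x _ => ?_
        ring
    _ ≤ 12 / (N * a) ^ 2 * (N + c ^ 2 * N + c ^ 2 * N) := by
        rw [h1]
        have : (1 : ℝ) ≤ N := by exact_mod_cast hN
        gcongr
    _ = _ := by
        field_simp
        ring

include hq hq1 hdisj hcard hi hj in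
/-- The kernel changes an i.i.d. distribution by `O(1/√N)`. -/
theorem sum_max_sub_flipKernel_le {c : ℝ} (hc : 0 < c) (hca : 2 * c * q j ^ m = q i ^ m)
    (hij : i ≠ j) (hm : 0 < m) (hN : 0 < N) :
    ∑ y : ι → C, max ((∏ t, q (y t)) - ∑ x, (∏ t, q (x t)) * flipKernel blk i j c x y) 0 ≤
      4 * (1 + c) / q i ^ m / √N := by
  have hN' : (0 : ℝ) < N := by exact_mod_cast hN
  have h2 : ∀ x : ι → C, 0 ≤ ∏ t, q (x t) := fun x => Finset.prod_nonneg fun t _ => hq _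
  have ha : 0 < q i ^ m := pow_pos hi m
  have ha' : 0 < q j ^ m := pow_pos hj m
  have hratio : (q i / q j) ^ m = 2 * c := by
    rw [div_pow, ← hca]; field_simp
  have hsN : 0 < √(N : ℝ) := Real.sqrt_pos.2 hN'
  have hss : √(N : ℝ) * √N = N := Real.mul_self_sqrt hN'.le
  have h1 := sum_prod_eq_one (ι := ι) q hq1
  have habs : ∀ (k : C), ∑ x : ι → C, (∏ t, q (x t)) * |blockCount blk k x - N * q k ^ m| ≤
      √N := by
    intro k
    have hu := sum_mul_sq_blockCount_le q hq1 hdisj hcard k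
    calc ∑ x : ι → C, (∏ t, q (x t)) * |blockCount blk k x - N * q k ^ m|
        ≤ ∑ x : ι → C, (∏ t, q (x t)) *
          ((blockCount blk k x - N * q k ^ m) ^ 2 / (2 * √N) + √N / 2) := by
          -- The inequality |z| ≤ z²/(2√N) + √N/2 passes from the variance to the first absolute
          -- moment.
          refine Finset.sum_le_sum fun x _ => mul_le_mul_of_nonneg_left ?_ (h2 x)
          set z := blockCount blk k x - N * q k ^ m
          rw [div_add_div _ _ (by positivity) (by norm_num), le_div_iff₀ (by positivity),
            ← sq_abs z]
          nlinarith [sq_nonneg (|z| - √N)]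
      _ = (∑ x : ι → C, (∏ t, q (x t)) * (blockCount blk k x - N * q k ^ m) ^ 2) / (2 * √N) +
          √N / 2 * ∑ x : ι → C, (∏ t, q (x t)) := by
          rw [Finset.sum_div, Finset.mul_sum, ← Finset.sum_add_distrib]
          refine Finset.sum_congr rfl fun x _ => ?_
          ring
      _ ≤ N / (2 * √N) + √N / 2 * 1 := by rw [h1]; gcongr
      _ = √N := by
          nth_rewrite 1 [← hss]
          field_simp
          norm_num
  have hu := habs i
  have hv := habs j
  set a := q i ^ m
  set a' := q j ^ m
  calc ∑ y : ι → C, max ((∏ t, q (y t)) - ∑ x, (∏ t, q (x t)) * flipKernel blk i j c x y) 0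
      ≤ ∑ y : ι → C, (∏ t, q (y t)) * (2 * (|blockCount blk i y - N * a| +
          2 * c * |blockCount blk j y - N * a'| + 1) / (N * a)) := by
        refine Finset.sum_le_sum fun y _ => ?_
        rw [sum_prod_mul_flipKernel hdisj hcard hm hij c q hj.ne', hratio]
        have h3 := mul_le_mul_of_nonneg_left (one_sub_div_max_le' (blockCount_nonneg blk i y)
          (blockCount_nonneg blk j y) hc ha hN' hca) (h2 y)
        refine le_trans (le_of_eq ?_) h3
        rw [mul_max_of_nonneg _ _ (h2 y)]
        congr 1 <;> ring
    _ = 2 / (N * a) * ((∑ x : ι → C, (∏ t, q (x t)) * |blockCount blk i x - N * a|) +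
          2 * c * (∑ x : ι → C, (∏ t, q (x t)) * |blockCount blk j x - N * a'|) +
          ∑ x : ι → C, (∏ t, q (x t))) := by
        rw [Finset.mul_sum, ← Finset.sum_add_distrib, ← Finset.sum_add_distrib, Finset.mul_sum]
        refine Finset.sum_congr rfl fun x _ => ?_
        ring
    _ ≤ 2 / (N * a) * (√N + 2 * c * √N + √N) := by
        rw [h1]
        have : (1 : ℝ) ≤ √N := by
          rw [Real.one_le_sqrt]; exact_mod_cast hN
        gcongr
    _ = _ := by
        nth_rewrite 1 [← hss]
        field_simp
        ring

end Deficit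

/-! ### The catalytic kernel -/

theorem exists_disjoint_blocks (n m : ℕ) (hm : 0 < m) :
    ∃ blk : Fin (n / m) → Finset (Fin n),
      (∀ b b', b ≠ b' → Disjoint (blk b) (blk b')) ∧ ∀ b, (blk b).card = m := by
  have hlt : ∀ (b : Fin (n / m)) (t : Fin m), (b : ℕ) * m + t < n := by
    intro b t
    have h1 : ((b : ℕ) + 1) * m ≤ n / m * m := Nat.mul_le_mul_right m b.2
    have h2 := Nat.div_mul_le_self n m
    have h3 := t.2
    rw [add_mul] at h1
    omega
  refine ⟨fun b => Finset.univ.map ⟨fun t : Fin m => (⟨(b : ℕ) * m + t, hlt b t⟩ : Fin n), ?_⟩,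
    ?_, ?_⟩
  · intro t s h
    simpa [Fin.ext_iff] using h
  · intro b b' hb
    rw [Finset.disjoint_left]
    intro x hx hx'
    simp only [Finset.mem_map, Finset.mem_univ, true_and] at hx hx'
    obtain ⟨t, rfl⟩ := hx
    obtain ⟨s, hs⟩ := hx'
    apply hb
    have h1 : ∀ (k : ℕ) (r : Fin m), (k * m + r) / m = k := fun k r => by
      rw [mul_comm, Nat.mul_add_div hm, Nat.div_eq_of_lt r.2, add_zero]
    have h2 : ((b' : ℕ) * m + s) / m = ((b : ℕ) * m + t) / m :=
      congrArg (fun z : Fin n => (z : ℕ) / m) hs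
    rw [h1, h1] at h2
    exact Fin.ext h2.symm
  · intro b
    simp

/-- The kernel is a product: forget the state of `S` and prepare `σ`, while flipping one block of
the catalyst. Preparing `σ` alone could violate Gibbs subinvariance by a factor up to (∑ g) / g s',
which the factor 2θ^m gained by the flip absorbs. -/
theorem exists_catalytic_kernel {S C : Type*} [Fintype S] [DecidableEq S] [Fintype C]
    [DecidableEq C] (g : S → ℝ) (hg : ∀ s, 0 < g s) (σ : S → ℝ) (hσ : ∀ s, 0 ≤ σ s)
    (hσ1 : ∑ s, σ s = 1) (q : C → ℝ) (hq : ∀ c, 0 ≤ q c) (hq1 : ∑ c, q c = 1)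
    (h : C → ℝ) (hh : ∀ c, 0 < h c) (i j : C) (hi : 0 < q i) (hj : 0 < q j)
    (hθ : h i * q j < h j * q i) :
    ∃ KC KS : ℝ, ∀ n : ℕ, 1 ≤ n → ∃ G : (S × (Fin n → C)) → (S × (Fin n → C)) → ℝ,
      (∀ a a', 0 ≤ G a a') ∧ (∀ a, ∑ a', G a a' ≤ 1) ∧
      (∀ a', ∑ a, (g a.1 * ∏ t, h (a.2 t)) * G a a' ≤ g a'.1 * ∏ t, h (a'.2 t)) ∧
      ∀ p : S → ℝ, ∑ s, p s = 1 →
        ∑ y, max ((∏ t, q (y t)) -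
          ∑ s', ∑ a : S × (Fin n → C), (p a.1 * ∏ t, q (a.2 t)) * G a (s', y)) 0 ≤ KC / √n ∧
        ∑ s', max (σ s' -
          ∑ y, ∑ a : S × (Fin n → C), (p a.1 * ∏ t, q (a.2 t)) * G a (s', y)) 0 ≤ KS / n := by
  have hij : i ≠ j := by
    rintro rfl
    exact lt_irrefl _ hθ
  set θ := (h i * q j) / (h j * q i) with hθdef
  have hden : 0 < h j * q i := mul_pos (hh j) hi
  have hθ0 : 0 ≤ θ := div_nonneg (mul_pos (hh i) hj).le hden.le
  have hθ1 : θ < 1 := (div_lt_one hden).2 hθ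
  obtain ⟨m, hm, hmθ⟩ : ∃ m : ℕ, 0 < m ∧ ∀ s', (∑ s, g s) * (2 * θ ^ m) ≤ g s' := by
    have h1 : Filter.Tendsto (fun m : ℕ => (∑ s, g s) * (2 * θ ^ m)) Filter.atTop (nhds 0) := by
      simpa using ((tendsto_pow_atTop_nhds_zero_of_lt_one hθ0 hθ1).const_mul 2).const_mul (∑ s, g s)
    have h2 : ∀ᶠ m in Filter.atTop, ∀ s', (∑ s, g s) * (2 * θ ^ m) ≤ g s' :=
      Filter.eventually_all.2 fun s' => (h1.eventually (gt_mem_nhds (hg s'))).mono fun _ h => h.le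
    obtain ⟨m, hm1, hm2⟩ := ((Filter.eventually_gt_atTop 0).and h2).exists
    exact ⟨m, hm1, hm2⟩
  -- Half the typical ratio of the counts: truncation is then atypical under `q`, yet it caps the
  -- Gibbs-weighted rate at 1/c everywhere.
  set c := q i ^ m / (2 * q j ^ m) with hcdef
  have hai : 0 < q i ^ m := pow_pos hi m
  have haj : 0 < q j ^ m := pow_pos hj m
  have hc : 0 < c := by positivity
  have hca : 2 * c * q j ^ m = q i ^ m := by rw [hcdef]; field_simp
  set AC := 4 * (1 + c) / q i ^ m with hAC
  set AS := 12 * (1 + 2 * c ^ 2) / (q i ^ m) ^ 2 with hAS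
  have hAC0 : 0 ≤ AC := by positivity
  have hAS0 : 0 ≤ AS := by positivity
  refine ⟨AC * (2 * m) + m, AS * (2 * m) + m, fun n hn => ?_⟩
  obtain ⟨blk, hdisj, hcard⟩ := exists_disjoint_blocks n m hm
  have hP : ∀ x : Fin n → C, 0 ≤ ∏ t, q (x t) := fun x => Finset.prod_nonneg fun t _ => hq _
  have hσle : ∀ s, σ s ≤ 1 := fun s =>
    (Finset.single_le_sum (fun s _ => hσ s) (Finset.mem_univ s)).trans hσ1.le
  have hn0 : (0 : ℝ) < n := by exact_mod_cast hn
  have hm0 : (0 : ℝ) < m := by exact_mod_cast hm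
  have hsn : 0 < √(n : ℝ) := Real.sqrt_pos.2 hn0
  have hboundS : ∑ x : Fin n → C, (∏ t, q (x t)) * (1 - ∑ y, flipKernel blk i j c x y) ≤
      (AS * (2 * m) + m) / n := by
    -- For n < m there are no blocks; the trivial bound 1 suffices and is absorbed by the summand
    -- `m` in the constant. Otherwise n ≤ 2m · (n / m) converts rates in the number of blocks into
    -- rates in `n`.
    rcases Nat.eq_zero_or_pos (n / m) with h0 | hpos
    · refine (sum_mul_one_sub_flipKernel_le_one hq hq1 hc).trans ?_
      rw [le_div_iff₀ hn0]
      have : (n : ℝ) ≤ m := by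
        exact_mod_cast (Nat.lt_of_div_eq_zero hm h0).le
      nlinarith [mul_nonneg hAS0 hm0.le]
    · refine (sum_mul_one_sub_flipKernel_le hq hq1 hdisj hcard hi hc hca hpos).trans ?_
      have hN : (n : ℝ) ≤ 2 * m * (n / m : ℕ) := by
        have h1 := Nat.lt_div_mul_add (a := n) hm
        have h2 : m * 1 ≤ m * (n / m) := Nat.mul_le_mul_left m hpos
        have h3 : n ≤ 2 * m * (n / m) := by nlinarith
        exact_mod_cast h3
      have hN0 : (0 : ℝ) < (n / m : ℕ) := by exact_mod_cast hpos
      rw [div_le_div_iff₀ hN0 hn0]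
      nlinarith [mul_le_mul_of_nonneg_left hN hAS0, mul_pos hm0 hN0]
  have hboundC : ∑ y : Fin n → C,
      max ((∏ t, q (y t)) - ∑ x, (∏ t, q (x t)) * flipKernel blk i j c x y) 0 ≤
      (AC * (2 * m) + m) / √n := by
    have hm1 : (1 : ℝ) ≤ m := by exact_mod_cast hm
    rcases Nat.eq_zero_or_pos (n / m) with h0 | hpos
    · refine (sum_max_sub_flipKernel_le_one hq hq1 hc).trans ?_
      rw [le_div_iff₀ hsn, one_mul]
      have h1 : (n : ℝ) ≤ m := by
        exact_mod_cast (Nat.lt_of_div_eq_zero hm h0).le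
      have h2 : √(n : ℝ) ≤ m := by
        rw [Real.sqrt_le_left hm0.le]
        nlinarith
      nlinarith [mul_nonneg hAC0 hm0.le]
    · refine (sum_max_sub_flipKernel_le hq hq1 hdisj hcard hi hj hc hca hij hm hpos).trans ?_
      have hN : (n : ℝ) ≤ 2 * m * (n / m : ℕ) := by
        have h1 := Nat.lt_div_mul_add (a := n) hm
        have h2 : m * 1 ≤ m * (n / m) := Nat.mul_le_mul_left m hpos
        have h3 : n ≤ 2 * m * (n / m) := by nlinarith
        exact_mod_cast h3
      have hN0 : (0 : ℝ) < (n / m : ℕ) := by exact_mod_cast hpos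
      have hsN0 : 0 < √((n / m : ℕ) : ℝ) := Real.sqrt_pos.2 hN0
      have hsq : √(n : ℝ) ≤ 2 * m * √((n / m : ℕ) : ℝ) := by
        rw [Real.sqrt_le_left (by positivity), mul_pow, Real.sq_sqrt hN0.le]
        refine hN.trans ?_
        gcongr
        nlinarith
      rw [div_le_div_iff₀ hsN0 hsn]
      nlinarith [mul_le_mul_of_nonneg_left hsq hAC0, mul_pos hm0 hsN0]
  refine ⟨fun a a' => σ a'.1 * flipKernel blk i j c a.2 a'.2, ?_, ?_, ?_, ?_⟩
  · exact fun a a' => mul_nonneg (hσ _) (flipKernel_nonneg blk i j hc _ _)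
  · rintro ⟨s, x⟩
    simp only [Fintype.sum_prod_type]
    rw [← Finset.sum_mul_sum, hσ1, one_mul]
    exact sum_flipKernel_le_one blk i j hc x
  · rintro ⟨s', y⟩
    have h1 : ∑ a : S × (Fin n → C), (g a.1 * ∏ t, h (a.2 t)) *
        (σ s' * flipKernel blk i j c a.2 y) =
        (σ s' * ∑ s, g s) * ∑ x, (∏ t, h (x t)) * flipKernel blk i j c x y := by
      rw [Fintype.sum_prod_type, mul_assoc, Finset.sum_mul_sum, Finset.mul_sum]
      refine Finset.sum_congr rfl fun s _ => ?_
      rw [Finset.mul_sum]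
      refine Finset.sum_congr rfl fun x _ => ?_
      ring
    simp only
    -- The identity that controls the disturbance for weights `q` is used here for the Gibbs weights
    -- `h`.
    rw [h1, sum_prod_mul_flipKernel hdisj hcard hm hij c h (hh j).ne']
    set l := blockCount blk j y
    set k := blockCount blk i y
    have hl : 0 ≤ l := blockCount_nonneg _ _ _
    have hk : 0 ≤ k := blockCount_nonneg _ _ _
    have h2 : l / max (k + 1) (c * l) ≤ 1 / c := by
      rw [div_le_div_iff₀ (lt_max_of_lt_left (by linarith)) hc, one_mul, mul_comm]
      exact le_max_right _ _
    have h3 : (h i / h j) ^ m * (1 / c) = 2 * θ ^ m := by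
      rw [hcdef, hθdef, div_pow, div_pow, mul_pow, mul_pow]
      have := (pow_pos (hh j) m).ne'
      field_simp
    have hH : 0 ≤ ∏ t, h (y t) := Finset.prod_nonneg fun t _ => (hh _).le
    have hgs : 0 ≤ ∑ s, g s := Finset.sum_nonneg fun s _ => (hg s).le
    have hr : 0 ≤ (h i / h j) ^ m := pow_nonneg (div_nonneg (hh i).le (hh j).le) m
    calc (σ s' * ∑ s, g s) * ((∏ t, h (y t)) * ((h i / h j) ^ m * (l / max (k + 1) (c * l))))
        ≤ (1 * ∑ s, g s) * ((∏ t, h (y t)) * ((h i / h j) ^ m * (1 / c))) := by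
          gcongr
          exact hσle s'
      _ = ((∑ s, g s) * (2 * θ ^ m)) * ∏ t, h (y t) := by rw [h3]; ring
      _ ≤ g s' * ∏ t, h (y t) := by gcongr; exact hmθ s'
  · intro p hp
    have hsum : ∀ s' y, ∑ a : S × (Fin n → C), (p a.1 * ∏ t, q (a.2 t)) *
        (σ s' * flipKernel blk i j c a.2 y) =
        σ s' * ∑ x, (∏ t, q (x t)) * flipKernel blk i j c x y := by
      intro s' y
      rw [Fintype.sum_prod_type, ← one_mul (σ s' * _), ← hp, Finset.sum_mul]
      refine Finset.sum_congr rfl fun s _ => ?_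
      rw [Finset.mul_sum, Finset.mul_sum]
      refine Finset.sum_congr rfl fun x _ => ?_
      ring
    simp only [hsum]
    constructor
    · simp only [← Finset.sum_mul, hσ1, one_mul]
      exact hboundC
    · have h1 : ∀ s', σ s' - ∑ y, σ s' * ∑ x, (∏ t, q (x t)) * flipKernel blk i j c x y =
          σ s' * ∑ x : Fin n → C, (∏ t, q (x t)) * (1 - ∑ y, flipKernel blk i j c x y) := by
        intro s'
        rw [← Finset.mul_sum, Finset.sum_comm]
        simp only [mul_sub, mul_one, Finset.sum_sub_distrib, sum_prod_eq_one q hq1,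
          ← Finset.mul_sum]
      have h2 : 0 ≤ ∑ x : Fin n → C, (∏ t, q (x t)) * (1 - ∑ y, flipKernel blk i j c x y) :=
        Finset.sum_nonneg fun x _ => mul_nonneg (hP x)
          (sub_nonneg.2 (sum_flipKernel_le_one blk i j hc x))
      have h3 : ∀ s', max (σ s' - ∑ y, σ s' * ∑ x, (∏ t, q (x t)) * flipKernel blk i j c x y) 0 =
          σ s' * ∑ x : Fin n → C, (∏ t, q (x t)) * (1 - ∑ y, flipKernel blk i j c x y) := by
        intro s'
        rw [h1]
        exact max_eq_left (mul_nonneg (hσ s') h2)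
      rw [Finset.sum_congr rfl fun s' _ => h3 s', ← Finset.sum_mul, hσ1, one_mul]
      exact hboundS

/-! ### Simultaneous diagonalisation and trace distance -/

section Diagonalization

variable {A : Type*} [Fintype A] [DecidableEq A]

/-- Commutation makes `M` block diagonal over the level sets of `E`. Diagonalising each block
separately gives a unitary that never mixes energies. -/
theorem exists_unitary_of_commute_diagonal (E : A → ℝ) (M : Matrix A A ℂ) (hM : M.IsHermitian)
    (h : Commute M (diagonal fun a => (E a : ℂ))) :
    ∃ W ∈ unitaryGroup A ℂ, Commute W (diagonal fun a => (E a : ℂ)) ∧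
      ∃ p : A → ℝ, M = W * diagonal (fun a => (p a : ℂ)) * Wᴴ := by
  classical
  have hzero : ∀ a b, E a ≠ E b → M a b = 0 := by
    intro a b hab
    have h1 := congrFun (congrFun h.eq a) b
    rw [mul_diagonal, diagonal_mul] at h1
    have h2 : ((E b : ℂ) - E a) * M a b = 0 := by rw [sub_mul, ← h1]; ring
    rcases mul_eq_zero.1 h2 with h3 | h3
    · exact absurd (by exact_mod_cast (sub_eq_zero.1 h3).symm) hab
    · exact h3
  obtain ⟨K, _, _, f, hf⟩ : ∃ (K : Type) (_ : Fintype K) (_ : DecidableEq K) (f : A → K),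
      ∀ a b, f a = f b ↔ E a = E b :=
    ⟨{r // r ∈ Finset.univ.image E}, FinsetCoe.fintype _, inferInstance,
      fun a => ⟨E a, Finset.mem_image_of_mem E (Finset.mem_univ a)⟩, fun a b => Subtype.mk_eq_mk⟩
  let e := Equiv.sigmaFiberEquiv f
  let B : ∀ k, Matrix {a // f a = k} {a // f a = k} ℂ := fun k => M.submatrix (·.1) (·.1)
  have hB : ∀ k, (B k).IsHermitian := fun k => hM.submatrix _
  have hMe : M.submatrix e e = blockDiagonal' B := by
    ext ⟨k, a⟩ ⟨k', b⟩
    rw [submatrix_apply]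
    by_cases hk : k = k'
    · subst hk
      rw [blockDiagonal'_apply_eq]
      rfl
    · rw [blockDiagonal'_apply_ne _ _ _ hk]
      refine hzero _ _ fun hE => hk ?_
      exact a.2.symm.trans (((hf a.1 b.1).2 hE).trans b.2)
  let W' := blockDiagonal' fun k =>
    ((hB k).eigenvectorUnitary : Matrix {a // f a = k} {a // f a = k} ℂ)
  let p' : (Σ k, {a // f a = k}) → ℝ := fun x => (hB x.1).eigenvalues x.2
  have hW' : W' * W'ᴴ = 1 := by
    rw [blockDiagonal'_conjTranspose, ← blockDiagonal'_mul, ← blockDiagonal'_one]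
    congr 1
    funext k
    exact Unitary.mul_star_self_of_mem (hB k).eigenvectorUnitary.2
  have hMW : blockDiagonal' B = W' * diagonal (fun x => (p' x : ℂ)) * W'ᴴ := by
    have : diagonal (fun x => (p' x : ℂ)) =
        blockDiagonal' fun k => diagonal fun a => ((hB k).eigenvalues a : ℂ) := by
      rw [blockDiagonal'_diagonal]
    rw [this, blockDiagonal'_conjTranspose, ← blockDiagonal'_mul, ← blockDiagonal'_mul]
    congr 1
    funext k
    conv_lhs => rw [(hB k).spectral_theorem]
    rfl
  have hback : ∀ X : Matrix A A ℂ, (X.submatrix e e).submatrix e.symm e.symm = X := fun X => by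
    simp
  refine ⟨W'.submatrix e.symm e.symm, ?_, ?_, fun a => p' (e.symm a), ?_⟩
  · rw [mem_unitaryGroup_iff, star_eq_conjTranspose, conjTranspose_submatrix, submatrix_mul_equiv,
      hW', submatrix_one_equiv]
  · have hd : diagonal (fun a => (E a : ℂ)) =
        (diagonal fun x : Σ k, {a // f a = k} => (E x.2 : ℂ)).submatrix e.symm e.symm := by
      rw [submatrix_diagonal_equiv]
      congr 1
    rw [hd]
    change _ * _ = _ * _
    rw [submatrix_mul_equiv, submatrix_mul_equiv]
    congr 1
    ext ⟨k, a⟩ ⟨k', b⟩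
    rw [mul_diagonal, diagonal_mul]
    by_cases hk : k = k'
    · subst hk
      have : E a = E b := (hf _ _).1 (a.2.trans b.2.symm)
      simp only [this]
      ring
    · have : W' ⟨k, a⟩ ⟨k', b⟩ = 0 := blockDiagonal'_apply_ne _ _ _ hk
      rw [this, zero_mul, mul_zero]
  · rw [← hback M, hMe, hMW, conjTranspose_submatrix]
    have : diagonal (fun a => (p' (e.symm a) : ℂ)) =
        (diagonal fun x => (p' x : ℂ)).submatrix e.symm e.symm := by
      rw [submatrix_diagonal_equiv]; rfl
    rw [this, submatrix_mul_equiv, submatrix_mul_equiv]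

/-- Simultaneous diagonalisation, with a fixed ordering of the spectrum of `H`. -/
theorem exists_unitary_simultaneous {H M : Matrix A A ℂ} (hH : H.IsHermitian) (hM : M.IsHermitian)
    (h : Commute M H) :
    ∃ V ∈ unitaryGroup A ℂ, H = V * diagonal (fun a => (hH.eigenvalues a : ℂ)) * Vᴴ ∧
      ∃ p : A → ℝ, M = V * diagonal (fun a => (p a : ℂ)) * Vᴴ := by
  set D : Matrix A A ℂ := diagonal (fun a => (hH.eigenvalues a : ℂ)) with hD
  let U : Matrix A A ℂ := hH.eigenvectorUnitary
  have hU : U ∈ unitaryGroup A ℂ := hH.eigenvectorUnitary.2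
  have hUU : U * Uᴴ = 1 := Unitary.mul_star_self_of_mem hU
  have hUU' : Uᴴ * U = 1 := Unitary.star_mul_self_of_mem hU
  have hHU : H = U * D * Uᴴ := by
    conv_lhs => rw [hH.spectral_theorem]
    rfl
  have hD' : D = Uᴴ * H * U := by
    calc D = (Uᴴ * U) * D * (Uᴴ * U) := by rw [hUU']; simp
      _ = Uᴴ * (U * D * Uᴴ) * U := by simp only [Matrix.mul_assoc]
      _ = _ := by rw [← hHU]
  have hc : Commute (Uᴴ * M * U) D := by
    rw [hD']
    change _ * _ = _ * _
    calc Uᴴ * M * U * (Uᴴ * H * U) = Uᴴ * M * (U * Uᴴ) * H * U := by simp only [Matrix.mul_assoc]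
      _ = Uᴴ * (M * H) * U := by rw [hUU]; simp only [Matrix.mul_assoc, Matrix.one_mul]
      _ = Uᴴ * (H * M) * U := by rw [h.eq]
      _ = Uᴴ * H * (U * Uᴴ) * M * U := by
        rw [hUU]; simp only [Matrix.mul_assoc, Matrix.one_mul]
      _ = _ := by simp only [Matrix.mul_assoc]
  obtain ⟨W, hW, hWD, p, hp⟩ := exists_unitary_of_commute_diagonal hH.eigenvalues (Uᴴ * M * U)
    (isHermitian_conjTranspose_mul_mul U hM) hc
  have hWW : W * Wᴴ = 1 := Unitary.mul_star_self_of_mem hW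
  refine ⟨U * W, mul_mem hU hW, ?_, p, ?_⟩
  · rw [conjTranspose_mul]
    calc H = U * D * Uᴴ := hHU
      _ = U * (D * (W * Wᴴ)) * Uᴴ := by rw [hWW, Matrix.mul_one]
      _ = U * ((D * W) * Wᴴ) * Uᴴ := by simp only [Matrix.mul_assoc]
      _ = U * ((W * D) * Wᴴ) * Uᴴ := by rw [hWD.eq]
      _ = _ := by simp only [Matrix.mul_assoc]
  · rw [conjTranspose_mul]
    calc M = (U * Uᴴ) * M * (U * Uᴴ) := by rw [hUU]; simp
      _ = U * (Uᴴ * M * U) * Uᴴ := by simp only [Matrix.mul_assoc]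
      _ = U * (W * diagonal (fun a => (p a : ℂ)) * Wᴴ) * Uᴴ := by rw [hp]
      _ = _ := by simp only [Matrix.mul_assoc]

theorem isState_conj_diagonal {M V : Matrix A A ℂ} (hM : IsState M) (hV : V ∈ unitaryGroup A ℂ)
    {p : A → ℝ} (hp : M = V * diagonal (fun a => (p a : ℂ)) * Vᴴ) :
    (∀ a, 0 ≤ p a) ∧ ∑ a, p a = 1 := by
  have hV' : Vᴴ * V = 1 := Unitary.star_mul_self_of_mem hV
  constructor
  · have h1 := hM.1.conjTranspose_mul_mul_same V
    have h2 : Vᴴ * M * V = diagonal (fun a => (p a : ℂ)) := by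
      rw [hp]
      calc Vᴴ * (V * diagonal (fun a => (p a : ℂ)) * Vᴴ) * V
          = (Vᴴ * V) * diagonal (fun a => (p a : ℂ)) * (Vᴴ * V) := by simp only [Matrix.mul_assoc]
        _ = _ := by rw [hV']; simp
    rw [h2] at h1
    intro a
    have := h1.diag_nonneg (i := a)
    simpa using this
  · have h1 := hM.2
    rw [hp, trace_mul_comm, ← Matrix.mul_assoc, hV', Matrix.one_mul, trace_diagonal] at h1
    exact_mod_cast h1

theorem trace_mul_conj_diagonal (P V : Matrix A A ℂ) (f : A → ℂ) :
    (P * (V * diagonal f * Vᴴ)).trace = ∑ a, (Vᴴ * P * V) a a * f a := by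
  have : (P * (V * diagonal f * Vᴴ)).trace = ((Vᴴ * P * V) * diagonal f).trace := by
    rw [← Matrix.mul_assoc, trace_mul_comm]
    simp only [Matrix.mul_assoc]
  rw [this, trace]
  simp [mul_diagonal]

/-- Only the diagonal of `Vᴴ * P * V`, with entries in [0, 1], enters the trace. By equal
normalisation, total excess equals total deficit. -/
theorem traceDist_conj_diagonal_le {V : Matrix A A ℂ} (hV : V ∈ unitaryGroup A ℂ) (p t : A → ℝ)
    (h : ∑ a, p a = ∑ a, t a) :
    traceDist (V * diagonal (fun a => (p a : ℂ)) * Vᴴ) (V * diagonal (fun a => (t a : ℂ)) * Vᴴ) ≤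
      ∑ a, max (t a - p a) 0 := by
  have hV' : Vᴴ * V = 1 := Unitary.star_mul_self_of_mem hV
  refine Real.sSup_le ?_ (Finset.sum_nonneg fun a _ => le_max_right _ _)
  rintro x ⟨P, hP, hP1, rfl⟩
  rw [← Matrix.sub_mul, ← Matrix.mul_sub, diagonal_sub, trace_mul_conj_diagonal, Complex.re_sum]
  have h0 : ∀ a, 0 ≤ ((Vᴴ * P * V) a a).re := fun a =>
    (Complex.nonneg_iff.1 ((hP.conjTranspose_mul_mul_same V).diag_nonneg (i := a))).1
  have h1 : ∀ a, ((Vᴴ * P * V) a a).re ≤ 1 := fun a => by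
    have h2 := (Complex.nonneg_iff.1 ((hP1.conjTranspose_mul_mul_same V).diag_nonneg (i := a))).1
    rw [Matrix.mul_sub, Matrix.sub_mul, Matrix.mul_one, hV'] at h2
    simpa using h2
  -- Adding a sum that is zero turns each deficit into the excess max (p a - t a) 0, so the
  -- comparison becomes termwise.
  have h3 : ∑ a, max (t a - p a) 0 = ∑ a, (max (t a - p a) 0 + (p a - t a)) := by
    rw [Finset.sum_add_distrib, Finset.sum_sub_distrib, h, sub_self, add_zero]
  rw [h3]
  refine Finset.sum_le_sum fun a _ => ?_
  have h4 : ((Vᴴ * P * V) a a * ((p a : ℂ) - t a)).re = ((Vᴴ * P * V) a a).re * (p a - t a) := by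
    rw [← Complex.ofReal_sub, Complex.re_mul_ofReal]
  rw [h4]
  rcases le_total (t a) (p a) with h5 | h5
  · rw [max_eq_right (by linarith)]
    nlinarith [h0 a, h1 a]
  · rw [max_eq_left (by linarith)]
    nlinarith [h0 a, h1 a]

end Diagonalization

/-! ### Partial traces and product bases -/

section PartialTrace

variable {A B : Type*} [Fintype A] [DecidableEq A] [Fintype B] [DecidableEq B]

theorem kronecker_conj_diagonal_apply (V : Matrix A A ℂ) (W : Matrix B B ℂ) (f : A × B → ℂ)
    (a a' : A) (b b' : B) :
    ((V ⊗ₖ W) * diagonal f * (V ⊗ₖ W)ᴴ) (a, b) (a', b') =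
      ∑ c, ∑ d, V a c * star (V a' c) * (W b d * star (W b' d)) * f (c, d) := by
  rw [mul_apply, Fintype.sum_prod_type]
  refine Finset.sum_congr rfl fun c _ => Finset.sum_congr rfl fun d _ => ?_
  rw [mul_diagonal, conjTranspose_apply, kronecker_apply, kronecker_apply, star_mul']
  ring

theorem conj_diagonal_apply (V : Matrix A A ℂ) (f : A → ℂ) (a a' : A) :
    (V * diagonal f * Vᴴ) a a' = ∑ c, V a c * star (V a' c) * f c := by
  rw [mul_apply]
  refine Finset.sum_congr rfl fun c _ => ?_
  rw [mul_diagonal, conjTranspose_apply]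
  ring

theorem sum_mul_star_of_mem_unitary {W : Matrix B B ℂ} (hW : W ∈ unitaryGroup B ℂ) (d : B) :
    ∑ b, W b d * star (W b d) = 1 := by
  have h : Wᴴ * W = 1 := Unitary.star_mul_self_of_mem hW
  have := congrFun (congrFun h d) d
  rw [mul_apply, one_apply_eq] at this
  rw [← this]
  exact Finset.sum_congr rfl fun b _ => by rw [conjTranspose_apply, mul_comm]

theorem traceSnd_conj_diagonal (V : Matrix A A ℂ) {W : Matrix B B ℂ} (hW : W ∈ unitaryGroup B ℂ)
    (f : A × B → ℂ) :
    traceSnd ((V ⊗ₖ W) * diagonal f * (V ⊗ₖ W)ᴴ) = V * diagonal (fun a => ∑ b, f (a, b)) * Vᴴ := by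
  ext a a'
  rw [conj_diagonal_apply]
  simp only [traceSnd, of_apply, kronecker_conj_diagonal_apply]
  rw [Finset.sum_comm]
  refine Finset.sum_congr rfl fun c _ => ?_
  rw [Finset.sum_comm, Finset.mul_sum]
  refine Finset.sum_congr rfl fun d _ => ?_
  rw [← Finset.sum_mul, ← Finset.mul_sum, sum_mul_star_of_mem_unitary hW, mul_one]

theorem traceFst_conj_diagonal {V : Matrix A A ℂ} (W : Matrix B B ℂ) (hV : V ∈ unitaryGroup A ℂ)
    (f : A × B → ℂ) :
    traceFst ((V ⊗ₖ W) * diagonal f * (V ⊗ₖ W)ᴴ) = W * diagonal (fun b => ∑ a, f (a, b)) * Wᴴ := by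
  ext b b'
  rw [conj_diagonal_apply]
  simp only [traceFst, of_apply, kronecker_conj_diagonal_apply]
  rw [Finset.sum_comm, Finset.sum_congr rfl fun c _ => Finset.sum_comm, Finset.sum_comm]
  refine Finset.sum_congr rfl fun d _ => ?_
  rw [Finset.mul_sum]
  refine Finset.sum_congr rfl fun c _ => ?_
  rw [← Finset.sum_mul, ← Finset.sum_mul, sum_mul_star_of_mem_unitary hV, one_mul]

theorem kronecker_mem_unitaryGroup {V : Matrix A A ℂ} {W : Matrix B B ℂ}
    (hV : V ∈ unitaryGroup A ℂ) (hW : W ∈ unitaryGroup B ℂ) :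
    V ⊗ₖ W ∈ unitaryGroup (A × B) ℂ :=
  kronecker_mem_unitary hV hW

theorem sumHam_conj {V : Matrix A A ℂ} {W : Matrix B B ℂ} (hV : V ∈ unitaryGroup A ℂ)
    (hW : W ∈ unitaryGroup B ℂ) (E : A → ℂ) (F : B → ℂ) :
    sumHam (V * diagonal E * Vᴴ) (W * diagonal F * Wᴴ) =
      (V ⊗ₖ W) * diagonal (fun x => E x.1 + F x.2) * (V ⊗ₖ W)ᴴ := by
  have hV' : V * Vᴴ = 1 := Unitary.mul_star_self_of_mem hV
  have hW' : W * Wᴴ = 1 := Unitary.mul_star_self_of_mem hW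
  have h1 : diagonal (fun x : A × B => E x.1 + F x.2) =
      diagonal E ⊗ₖ (1 : Matrix B B ℂ) + (1 : Matrix A A ℂ) ⊗ₖ diagonal F := by
    rw [← diagonal_one, ← diagonal_one, diagonal_kronecker_diagonal, diagonal_kronecker_diagonal,
      diagonal_add]
    simp
  rw [h1, conjTranspose_kronecker, Matrix.mul_add, Matrix.add_mul, ← mul_kronecker_mul,
    ← mul_kronecker_mul, ← mul_kronecker_mul, ← mul_kronecker_mul, Matrix.mul_one, Matrix.mul_one,
    hV', hW', sumHam]

theorem kronecker_conj (V : Matrix A A ℂ) (W : Matrix B B ℂ) (E : A → ℂ) (F : B → ℂ) :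
    (V * diagonal E * Vᴴ) ⊗ₖ (W * diagonal F * Wᴴ) =
      (V ⊗ₖ W) * diagonal (fun x => E x.1 * F x.2) * (V ⊗ₖ W)ᴴ := by
  rw [mul_kronecker_mul, mul_kronecker_mul, diagonal_kronecker_diagonal, conjTranspose_kronecker]

end PartialTrace

/-! ### Tensor powers in a product eigenbasis -/

section Tensor

set_option linter.unusedSectionVars false

variable {C : Type*} [Fintype C] [DecidableEq C] {n : ℕ}

/-- The tensor product of a family of matrices. -/
def tensorFam (M : Fin n → Matrix C C ℂ) : Matrix (Fin n → C) (Fin n → C) ℂ :=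
  Matrix.of fun x y => ∏ i, M i (x i) (y i)

theorem tensorPow_eq_tensorFam (M : Matrix C C ℂ) : tensorPow n M = tensorFam fun _ => M := rfl

theorem tensorFam_mul (M N : Fin n → Matrix C C ℂ) :
    tensorFam M * tensorFam N = tensorFam fun i => M i * N i := by
  ext x y
  simp only [tensorFam, mul_apply, of_apply, ← Finset.prod_mul_distrib]
  rw [Finset.prod_univ_sum, Fintype.piFinset_univ]

theorem tensorFam_diagonal (d : Fin n → C → ℂ) :
    tensorFam (fun i => diagonal (d i)) = diagonal fun x => ∏ i, d i (x i) := by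
  ext x y
  simp only [tensorFam, of_apply]
  by_cases h : x = y
  · subst h; simp
  · rw [diagonal_apply_ne _ h]
    obtain ⟨i, hi⟩ := Function.ne_iff.1 h
    exact Finset.prod_eq_zero (Finset.mem_univ i) (diagonal_apply_ne _ hi)

theorem tensorFam_conjTranspose (M : Fin n → Matrix C C ℂ) :
    (tensorFam M)ᴴ = tensorFam fun i => (M i)ᴴ := by
  ext x y
  simp [tensorFam, conjTranspose_apply]

theorem tensorPow_mem_unitaryGroup {V : Matrix C C ℂ} (hV : V ∈ unitaryGroup C ℂ) :
    tensorPow n V ∈ unitaryGroup (Fin n → C) ℂ := by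
  have hV' : V * Vᴴ = 1 := Unitary.mul_star_self_of_mem hV
  rw [mem_unitaryGroup_iff, star_eq_conjTranspose, tensorPow_eq_tensorFam, tensorFam_conjTranspose,
    tensorFam_mul]
  simp only [hV', ← diagonal_one]
  rw [tensorFam_diagonal]
  simp

theorem tensorPow_conj (V : Matrix C C ℂ) (f : C → ℂ) :
    tensorPow n (V * diagonal f * Vᴴ) =
      tensorPow n V * diagonal (fun x => ∏ t, f (x t)) * (tensorPow n V)ᴴ := by
  simp only [tensorPow_eq_tensorFam]
  rw [tensorFam_conjTranspose, ← tensorFam_diagonal, tensorFam_mul, tensorFam_mul]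

theorem copiesHam_eq_sum (H : Matrix C C ℂ) :
    copiesHam n H = ∑ i, tensorFam (Function.update (fun _ => 1) i H) := by
  unfold copiesHam
  refine Finset.sum_congr rfl fun i _ => ?_
  ext x y
  simp only [tensorFam, of_apply]
  rw [← Finset.mul_prod_erase _ _ (Finset.mem_univ i), Function.update_self]
  split_ifs with h
  · rw [Finset.prod_eq_one, mul_one]
    intro j hj
    rw [Function.update_of_ne (Finset.ne_of_mem_erase hj), h j (Finset.ne_of_mem_erase hj),
      one_apply_eq]
  · push Not at h
    obtain ⟨j, hj, hne⟩ := h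
    rw [Finset.prod_eq_zero (Finset.mem_erase.2 ⟨hj, Finset.mem_univ j⟩), mul_zero]
    rw [Function.update_of_ne hj, one_apply_ne hne]

theorem copiesHam_conj {V : Matrix C C ℂ} (hV : V ∈ unitaryGroup C ℂ) (f : C → ℂ) :
    copiesHam n (V * diagonal f * Vᴴ) =
      tensorPow n V * diagonal (fun x => ∑ t, f (x t)) * (tensorPow n V)ᴴ := by
  have hV' : V * Vᴴ = 1 := Unitary.mul_star_self_of_mem hV
  have hd : diagonal (fun x : Fin n → C => ∑ t, f (x t)) =
      ∑ i, tensorFam (Function.update (fun _ => 1) i (diagonal f)) := by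
    have : ∀ i : Fin n, tensorFam (Function.update (fun _ => 1) i (diagonal f)) =
        diagonal fun x => f (x i) := by
      intro i
      have h1 : Function.update (fun _ => (1 : Matrix C C ℂ)) i (diagonal f) =
          fun j => diagonal (Function.update (fun _ _ => 1) i f j) := by
        funext j
        by_cases h : j = i
        · subst h; simp
        · rw [Function.update_of_ne h, Function.update_of_ne h, diagonal_one]
      rw [h1, tensorFam_diagonal]
      congr 1
      funext x
      rw [← Finset.mul_prod_erase _ _ (Finset.mem_univ i), Function.update_self,
        Finset.prod_eq_one, mul_one]
      intro j hj
      rw [Function.update_of_ne (Finset.ne_of_mem_erase hj)]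
    rw [Finset.sum_congr rfl fun i _ => this i]
    ext x y
    rw [Matrix.sum_apply]
    by_cases h : x = y
    · subst h; simp
    · simp [h]
  rw [hd, copiesHam_eq_sum, Finset.mul_sum, Finset.sum_mul]
  refine Finset.sum_congr rfl fun i _ => ?_
  rw [tensorPow_eq_tensorFam, tensorFam_conjTranspose, tensorFam_mul, tensorFam_mul]
  congr 1
  funext j
  by_cases h : j = i
  · subst h; simp
  · rw [Function.update_of_ne h, Function.update_of_ne h, Matrix.mul_one, hV']

end Tensor

/-! ### Thermal states, athermality, and thermal operations from permutations -/

section Thermal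

variable {A : Type*} [Fintype A] [DecidableEq A]

theorem exp_diagonal_ofReal (β : ℝ) (E : A → ℝ) :
    NormedSpace.exp (-((β : ℂ) • diagonal fun a => (E a : ℂ))) =
      diagonal fun a => ((Real.exp (-(β * E a)) : ℝ) : ℂ) := by
  have : -((β : ℂ) • diagonal fun a => (E a : ℂ)) = diagonal fun a => ((-(β * E a) : ℝ) : ℂ) := by
    rw [← diagonal_smul, diagonal_neg]
    congr 1
    funext a
    simp
  rw [this, exp_diagonal]
  congr 1
  funext a
  rw [Pi.coe_exp, ← Complex.exp_eq_exp_ℂ, Complex.ofReal_exp]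

theorem thermalState_diagonal (β : ℝ) (E : A → ℝ) :
    thermalState β (diagonal fun a => (E a : ℂ)) =
      diagonal fun a => ((Real.exp (-(β * E a)) / ∑ b, Real.exp (-(β * E b)) : ℝ) : ℂ) := by
  rw [thermalState, exp_diagonal_ofReal, trace_diagonal, ← diagonal_smul]
  congr 1
  funext a
  simp [div_eq_inv_mul]

theorem thermalState_conj {V : Matrix A A ℂ} (hV : V ∈ unitaryGroup A ℂ) (β : ℝ) (E : A → ℝ) :
    thermalState β (V * (diagonal fun a => (E a : ℂ)) * Vᴴ) =
      V * thermalState β (diagonal fun a => (E a : ℂ)) * Vᴴ := by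
  have hV1 : Vᴴ * V = 1 := Unitary.star_mul_self_of_mem hV
  have hV2 : V * Vᴴ = 1 := Unitary.mul_star_self_of_mem hV
  have hinv : V⁻¹ = Vᴴ := inv_eq_right_inv hV2
  have hu : IsUnit V := ⟨⟨V, Vᴴ, hV2, hV1⟩, rfl⟩
  have h1 : -((β : ℂ) • (V * (diagonal fun a => (E a : ℂ)) * Vᴴ)) =
      V * (-((β : ℂ) • diagonal fun a => (E a : ℂ))) * V⁻¹ := by
    rw [hinv]; simp
  rw [thermalState, h1, exp_conj _ _ hu, thermalState, hinv, trace_mul_comm, ← Matrix.mul_assoc,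
    hV1, Matrix.one_mul]
  simp

/-- A state that is not truncated thermal has two populated levels whose populations are not in
the Gibbs ratio. -/
theorem exists_athermal_pair {β : ℝ} {V : Matrix A A ℂ} (hV : V ∈ unitaryGroup A ℂ) {E q : A → ℝ}
    (hq : ∀ a, 0 ≤ q a) (hq1 : ∑ a, q a = 1)
    (h : ¬ IsTruncatedThermal β (V * (diagonal fun a => (E a : ℂ)) * Vᴴ)
      (V * (diagonal fun a => (q a : ℂ)) * Vᴴ)) :
    ∃ i j, 0 < q i ∧ 0 < q j ∧
      Real.exp (-(β * E i)) * q j < Real.exp (-(β * E j)) * q i := by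
  by_contra hcon
  push Not at hcon
  apply h
  have hV1 : Vᴴ * V = 1 := Unitary.star_mul_self_of_mem hV
  have hmul : ∀ f g : A → ℂ, (V * diagonal f * Vᴴ) * (V * diagonal g * Vᴴ) =
      V * diagonal (fun a => f a * g a) * Vᴴ := by
    intro f g
    calc (V * diagonal f * Vᴴ) * (V * diagonal g * Vᴴ)
        = V * diagonal f * (Vᴴ * V) * diagonal g * Vᴴ := by simp only [Matrix.mul_assoc]
      _ = V * (diagonal f * diagonal g) * Vᴴ := by
        rw [hV1, Matrix.mul_one]; simp only [Matrix.mul_assoc]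
      _ = _ := by rw [diagonal_mul_diagonal]
  obtain ⟨k, hk⟩ : ∃ k, 0 < q k := by
    by_contra hn
    push Not at hn
    have := Finset.sum_nonpos fun a (_ : a ∈ Finset.univ) => hn a
    linarith
  have hprop : ∀ a, q a ≠ 0 → q a = q k / Real.exp (-(β * E k)) * Real.exp (-(β * E a)) := by
    intro a ha
    have ha' : 0 < q a := lt_of_le_of_ne (hq a) (Ne.symm ha)
    have h1 := le_antisymm (hcon k a hk ha') (hcon a k ha' hk)
    rw [div_mul_eq_mul_div, eq_div_iff (Real.exp_pos _).ne']
    linarith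
  set c := q k / Real.exp (-(β * E k))
  have hc : 0 < c := div_pos hk (Real.exp_pos _)
  set Z := ∑ b, Real.exp (-(β * E b))
  have hZ : 0 < Z := Finset.sum_pos (fun b _ => Real.exp_pos _) ⟨k, Finset.mem_univ k⟩
  -- The projection onto the populated levels, on which `q` is proportional to the Gibbs weights.
  refine ⟨V * diagonal (fun a => if q a = 0 then 0 else 1) * Vᴴ, ?_, ?_, ?_, ?_⟩
  · rw [IsHermitian, conjTranspose_mul, conjTranspose_mul, conjTranspose_conjTranspose,
      diagonal_conjTranspose, Matrix.mul_assoc]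
    congr 3
    funext a
    by_cases ha : q a = 0 <;> simp [ha]
  · rw [hmul]
    congr 3
    funext a
    split_ifs <;> simp
  · change _ * _ = _ * _
    rw [hmul, hmul]
    congr 3
    funext a
    ring
  · rw [thermalState_conj hV, thermalState_diagonal, hmul]
    have h1 : (fun a => (if q a = 0 then (0 : ℂ) else 1) *
        ((Real.exp (-(β * E a)) / Z : ℝ) : ℂ)) = fun a => ((c * Z)⁻¹ : ℂ) * (q a : ℂ) := by
      funext a
      split_ifs with ha
      · simp [ha]
      · rw [hprop a ha]
        push_cast
        have : (c : ℂ) ≠ 0 := by exact_mod_cast hc.ne'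
        have : (Z : ℂ) ≠ 0 := by exact_mod_cast hZ.ne'
        field_simp
    have hcZ : ((c : ℂ) * Z) ≠ 0 := by exact_mod_cast (mul_pos hc hZ).ne'
    rw [h1]
    have h2 : diagonal (fun a => ((c * Z)⁻¹ : ℂ) * (q a : ℂ)) =
        ((c * Z)⁻¹ : ℂ) • diagonal (fun a => (q a : ℂ)) := by
      rw [← diagonal_smul]; rfl
    have h3 : (V * diagonal (fun a => (q a : ℂ)) * Vᴴ).trace = 1 := by
      rw [trace_mul_comm, ← Matrix.mul_assoc, hV1, Matrix.one_mul, trace_diagonal]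
      exact_mod_cast hq1
    rw [h2, Matrix.mul_smul, Matrix.smul_mul, trace_smul, h3, smul_smul]
    rw [smul_eq_mul, mul_one, inv_inv, mul_inv_cancel₀ hcZ, one_smul]

/-- Energy-conserving permutations of system and bath levels induce thermal operations. -/
theorem exists_isThermalOperation_of_perm {β : ℝ} {H V V' : Matrix A A ℂ} {E : A → ℝ}
    (hV : V ∈ unitaryGroup A ℂ) (hV' : V' ∈ unitaryGroup A ℂ)
    (hH : H = V * (diagonal fun a => (E a : ℂ)) * Vᴴ)
    (hH' : H = V' * (diagonal fun a => (E a : ℂ)) * V'ᴴ) {d : ℕ} (hd : 0 < d) (F : Fin d → ℝ)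
    (π : Equiv.Perm (A × Fin d)) (hπ : ∀ x, E (π x).1 + F (π x).2 = E x.1 + F x.2) :
    ∃ T, IsThermalOperation β H T ∧ ∀ p : A → ℝ,
      T (V * (diagonal fun a => (p a : ℂ)) * Vᴴ) = V' * (diagonal fun a' =>
        ((∑ a, p a * ∑ b, Real.exp (-(β * F b)) / (∑ b', Real.exp (-(β * F b'))) *
          (if (π (a, b)).1 = a' then 1 else 0) : ℝ) : ℂ)) * V'ᴴ := by
  let τ : Fin d → ℝ := fun b => Real.exp (-(β * F b)) / ∑ b', Real.exp (-(β * F b'))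
  let Q : Matrix (A × Fin d) (A × Fin d) ℂ := (1 : Matrix _ _ ℂ).submatrix π.symm id
  have hQ : ∀ f : A × Fin d → ℂ, Q * diagonal f * Qᴴ = diagonal fun x => f (π.symm x) := by
    intro f
    ext x y
    rw [mul_apply]
    simp only [Q, mul_diagonal, conjTranspose_apply, submatrix_apply, id, one_apply]
    simp only [ite_mul, one_mul, zero_mul, Finset.sum_ite_eq, Finset.mem_univ, if_true]
    by_cases h : x = y
    · subst h; simp
    · rw [diagonal_apply_ne _ h, if_neg (fun h' => h (π.symm.injective h'.symm))]
      simp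
  have hQu : Q ∈ unitaryGroup (A × Fin d) ℂ := by
    rw [mem_unitaryGroup_iff, star_eq_conjTranspose]
    have := hQ fun _ => 1
    simpa using this
  have hQ1 : Qᴴ * Q = 1 := Unitary.star_mul_self_of_mem hQu
  let I : Matrix (Fin d) (Fin d) ℂ := 1
  have hI : I ∈ unitaryGroup (Fin d) ℂ := one_mem _
  have hVI := kronecker_mem_unitaryGroup hV hI
  have hVI' := kronecker_mem_unitaryGroup hV' hI
  set X := V ⊗ₖ I
  set X' := V' ⊗ₖ I
  have hX1 : Xᴴ * X = 1 := Unitary.star_mul_self_of_mem hVI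
  have hX1' : X'ᴴ * X' = 1 := Unitary.star_mul_self_of_mem hVI'
  let HB : Matrix (Fin d) (Fin d) ℂ := diagonal fun b => (F b : ℂ)
  let Δ : Matrix (A × Fin d) (A × Fin d) ℂ := diagonal fun x => (E x.1 : ℂ) + F x.2
  have hIHB : HB = I * HB * Iᴴ := by simp [I]
  have hs : sumHam H HB = X * Δ * Xᴴ := by
    rw [hIHB, hH]; exact sumHam_conj hV hI _ _
  have hs' : sumHam H HB = X' * Δ * X'ᴴ := by
    rw [hIHB, hH']; exact sumHam_conj hV' hI _ _
  have hQΔ : Q * Δ = Δ * Q := by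
    have h1 : Q * Δ * Qᴴ = Δ := by
      rw [hQ]
      congr 1
      funext x
      have := hπ (π.symm x)
      rw [π.apply_symm_apply] at this
      exact_mod_cast this.symm
    calc Q * Δ = Q * Δ * (Qᴴ * Q) := by rw [hQ1, Matrix.mul_one]
      _ = (Q * Δ * Qᴴ) * Q := by simp only [Matrix.mul_assoc]
      _ = Δ * Q := by rw [h1]
  have hτ : ∀ p : A → ℝ, (V * (diagonal fun a => (p a : ℂ)) * Vᴴ) ⊗ₖ thermalState β HB =
      X * diagonal (fun x => (p x.1 : ℂ) * (τ x.2 : ℂ)) * Xᴴ := by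
    intro p
    have : thermalState β HB = I * diagonal (fun b => (τ b : ℂ)) * Iᴴ := by
      rw [thermalState_diagonal]; simp [I, τ]
    rw [this]
    exact kronecker_conj V I _ _
  -- Input and output eigenbases may differ, because `ρ` and `σ` need not commute. The unitary reads
  -- the first basis, permutes, and writes in the second; it conserves energy because both bases
  -- carry the same energy function `E`.
  refine ⟨fun M => traceSnd ((X' * Q * Xᴴ) * (M ⊗ₖ thermalState β HB) * (X' * Q * Xᴴ)ᴴ),
    ⟨d, HB, X' * Q * Xᴴ, hd, ?_, ?_, ?_, fun _ => rfl⟩, fun p => ?_⟩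
  · rw [isHermitian_diagonal_iff]
    intro b
    simp [IsSelfAdjoint]
  · exact mul_mem (mul_mem hVI' hQu) (Unitary.star_mem hVI)
  · change _ * _ = _ * _
    calc X' * Q * Xᴴ * sumHam H HB = X' * Q * (Xᴴ * X) * Δ * Xᴴ := by
          rw [hs]; simp only [Matrix.mul_assoc]
      _ = X' * (Q * Δ) * Xᴴ := by rw [hX1, Matrix.mul_one]; simp only [Matrix.mul_assoc]
      _ = X' * Δ * (X'ᴴ * X') * Q * Xᴴ := by
          rw [hQΔ, hX1', Matrix.mul_one]; simp only [Matrix.mul_assoc]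
      _ = sumHam H HB * (X' * Q * Xᴴ) := by rw [hs']; simp only [Matrix.mul_assoc]
  · simp only
    have h1 : (X' * Q * Xᴴ) * (X * diagonal (fun x => (p x.1 : ℂ) * (τ x.2 : ℂ)) * Xᴴ) *
        (X' * Q * Xᴴ)ᴴ = X' * (Q * diagonal (fun x => (p x.1 : ℂ) * (τ x.2 : ℂ)) * Qᴴ) * X'ᴴ := by
      rw [conjTranspose_mul, conjTranspose_mul, conjTranspose_conjTranspose]
      calc _ = X' * Q * (Xᴴ * X) * diagonal (fun x => (p x.1 : ℂ) * (τ x.2 : ℂ)) * (Xᴴ * X) *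
            Qᴴ * X'ᴴ := by simp only [Matrix.mul_assoc]
        _ = _ := by rw [hX1]; simp only [Matrix.mul_assoc, Matrix.mul_one]
    rw [hτ, h1, hQ, traceSnd_conj_diagonal V' hI]
    congr 3
    funext a'
    have h2 : ∑ b, (p (π.symm (a', b)).1 : ℂ) * (τ (π.symm (a', b)).2 : ℂ) =
        ∑ x : A × Fin d, if x.1 = a' then (p (π.symm x).1 : ℂ) * (τ (π.symm x).2 : ℂ) else 0 := by
      rw [Fintype.sum_prod_type, Finset.sum_eq_single a']
      · simp
      · intro b _ hb; simp [hb]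
      · simp
    rw [h2, ← Equiv.sum_comp π, Fintype.sum_prod_type]
    push_cast
    refine Finset.sum_congr rfl fun a _ => ?_
    rw [Finset.mul_sum]
    refine Finset.sum_congr rfl fun b _ => ?_
    simp only [Equiv.symm_apply_apply]
    split_ifs <;> simp [τ]

end Thermal

/-! ### Assembly of the theorem -/

theorem sum_channel_eq_one {A : Type*} [Fintype A] [DecidableEq A] {β : ℝ} {d : ℕ} (hd : 0 < d)
    (F : Fin d → ℝ) (f : A → Fin d → A) (p : A → ℝ) (hp : ∑ a, p a = 1) :
    ∑ a', ∑ a, p a * ∑ b, Real.exp (-(β * F b)) / (∑ b', Real.exp (-(β * F b'))) *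
      (if f a b = a' then 1 else 0) = 1 := by
  have hZ : 0 < ∑ b', Real.exp (-(β * F b')) :=
    Finset.sum_pos (fun b _ => Real.exp_pos _) ⟨⟨0, hd⟩, Finset.mem_univ _⟩
  rw [Finset.sum_comm]
  refine Eq.trans ?_ hp
  refine Finset.sum_congr rfl fun a _ => ?_
  rw [← Finset.mul_sum, Finset.sum_comm]
  simp only [mul_ite, mul_one, mul_zero, Finset.sum_ite_eq, Finset.mem_univ, if_true]
  rw [← Finset.sum_div, div_self hZ.ne', mul_one]

theorem sum_max_sub_sum_le {X Y : Type*} [Fintype X] [Fintype Y] (t : X → ℝ) (u v : X → Y → ℝ)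
    (ε : ℝ) (hε : 0 ≤ ε) (h : ∀ x y, u x y - ε ≤ v x y) :
    ∑ x, max (t x - ∑ y, v x y) 0 ≤
      ∑ x, max (t x - ∑ y, u x y) 0 + Fintype.card X * Fintype.card Y * ε := by
  have h1 : ∀ x, max (t x - ∑ y, v x y) 0 ≤ max (t x - ∑ y, u x y) 0 + Fintype.card Y * ε := by
    intro x
    have h2 : ∑ y, (u x y - ε) ≤ ∑ y, v x y := Finset.sum_le_sum fun y _ => h x y
    rw [Finset.sum_sub_distrib, Finset.sum_const, Finset.card_univ, nsmul_eq_mul] at h2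
    have h3 : 0 ≤ (Fintype.card Y : ℝ) * ε := by positivity
    refine max_le ?_ (add_nonneg (le_max_right _ _) h3)
    linarith [le_max_left (t x - ∑ y, u x y) 0]
  refine (Finset.sum_le_sum fun x _ => h1 x).trans (le_of_eq ?_)
  rw [Finset.sum_add_distrib, Finset.sum_const, Finset.card_univ, nsmul_eq_mul]
  ring

end ThermoCat

theorem theorem1 {S C : Type*} [Fintype S] [DecidableEq S] [Fintype C] [DecidableEq C]
    (β : ℝ) (hβ : 0 < β)
    (HS : Matrix S S ℂ) (hHS : HS.IsHermitian)
    (HC : Matrix C C ℂ) (hHC : HC.IsHermitian)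
    (ρ σ : Matrix S S ℂ)
    (hρ : ThermoCat.IsState ρ) (hρH : Commute ρ HS)
    (hσ : ThermoCat.IsState σ) (hσH : Commute σ HS)
    (ω : Matrix C C ℂ)
    (hω : ThermoCat.IsState ω) (hωH : Commute ω HC)
    (hωT : ¬ ThermoCat.IsTruncatedThermal β HC ω) :
    ∃ KC KS : ℝ, ∀ n : ℕ, 1 ≤ n →
      ∃ T : Matrix (S × (Fin n → C)) (S × (Fin n → C)) ℂ →
          Matrix (S × (Fin n → C)) (S × (Fin n → C)) ℂ,
        ThermoCat.IsThermalOperation β (ThermoCat.sumHam HS (ThermoCat.copiesHam n HC)) T ∧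
        ThermoCat.traceDist
            (ThermoCat.traceFst (T (ρ ⊗ₖ ThermoCat.tensorPow n ω)))
            (ThermoCat.tensorPow n ω) ≤ KC / Real.sqrt n ∧
        ThermoCat.traceDist
            (ThermoCat.traceSnd (T (ρ ⊗ₖ ThermoCat.tensorPow n ω))) σ ≤ KS / n := by
  open ThermoCat in
  obtain ⟨V, hV, hHV, p, hp⟩ := exists_unitary_simultaneous hHS hρ.1.1 hρH
  obtain ⟨V', hV', hHV', s, hs⟩ := exists_unitary_simultaneous hHS hσ.1.1 hσH
  obtain ⟨W, hW, hHW, q, hq⟩ := exists_unitary_simultaneous hHC hω.1.1 hωH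
  -- Both diagonalisations of `HS` must share one energy function. Abstracting it also keeps the
  -- right-hand sides from mentioning `HS` and `HC`.
  generalize hHS.eigenvalues = ES at hHV hHV'
  generalize hHC.eigenvalues = EC at hHW
  obtain ⟨hp0, hp1⟩ := isState_conj_diagonal hρ hV hp
  obtain ⟨hs0, hs1⟩ := isState_conj_diagonal hσ hV' hs
  obtain ⟨hq0, hq1⟩ := isState_conj_diagonal hω hW hq
  rw [hHW, hq] at hωT
  obtain ⟨i, j, hi, hj, hij⟩ := exists_athermal_pair hW hq0 hq1 hωT
  obtain ⟨KC, KS, hK⟩ := exists_catalytic_kernel (fun a => Real.exp (-(β * ES a)))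
    (fun _ => Real.exp_pos _) s hs0 hs1 q hq0 hq1 (fun c => Real.exp (-(β * EC c)))
    (fun _ => Real.exp_pos _) i j hi hj hij
  refine ⟨KC + 1, KS + 1, fun n hn => ?_⟩
  obtain ⟨G, hG0, hGrow, hGcol, hGout⟩ := hK n hn
  obtain ⟨hGC, hGS⟩ := hGout p hp1
  have hSne : Nonempty S := by
    by_contra hne
    rw [not_nonempty_iff] at hne
    simp at hp1
  have hCne : Nonempty C := ⟨i⟩
  have hn0 : (0 : ℝ) < n := by exact_mod_cast hn
  have hsn0 : 0 < √(n : ℝ) := Real.sqrt_pos.2 hn0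
  have hcS : (0 : ℝ) < Fintype.card S := by exact_mod_cast Fintype.card_pos
  have hcX : (0 : ℝ) < Fintype.card (Fin n → C) := by exact_mod_cast Fintype.card_pos
  let E : S × (Fin n → C) → ℝ := fun a => ES a.1 + ∑ t, EC (a.2 t)
  have hE : ∀ a, Real.exp (-(β * E a)) =
      Real.exp (-(β * ES a.1)) * ∏ t, Real.exp (-(β * EC (a.2 t))) := by
    intro a
    rw [← Real.exp_sum, ← Real.exp_add, Finset.sum_neg_distrib, ← Finset.mul_sum]
    congr 1
    simp only [E]
    ring
  -- Summed over all joint levels the bath error is then exactly 1/n, which the extra 1 in each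
  -- constant covers.
  let ε : ℝ := 1 / (n * (Fintype.card S * Fintype.card (Fin n → C)))
  have hε : 0 < ε := by positivity
  obtain ⟨d, F, π, hd, hπ, hTG⟩ := exists_conserving_perm β E G hG0 hGrow
    (by simpa only [hE] using hGcol) ε hε
  have hWn := tensorPow_mem_unitaryGroup (n := n) hW
  have hcopies : copiesHam n HC = tensorPow n W *
      diagonal (fun x => ∑ t, (EC (x t) : ℂ)) * (tensorPow n W)ᴴ := by
    conv_lhs => rw [hHW]
    exact copiesHam_conj hW _
  have hωn : tensorPow n ω = tensorPow n W *
      diagonal (fun x => ((∏ t, q (x t) : ℝ) : ℂ)) * (tensorPow n W)ᴴ := by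
    conv_lhs => rw [hq]
    rw [tensorPow_conj]
    simp only [Complex.ofReal_prod]
  have hH : sumHam HS (copiesHam n HC) = (V ⊗ₖ tensorPow n W) *
      diagonal (fun a => (E a : ℂ)) * (V ⊗ₖ tensorPow n W)ᴴ := by
    conv_lhs => rw [hHV, hcopies]
    rw [sumHam_conj hV hWn]
    simp [E]
  have hH' : sumHam HS (copiesHam n HC) = (V' ⊗ₖ tensorPow n W) *
      diagonal (fun a => (E a : ℂ)) * (V' ⊗ₖ tensorPow n W)ᴴ := by
    conv_lhs => rw [hHV', hcopies]
    rw [sumHam_conj hV' hWn]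
    simp [E]
  have hin : ρ ⊗ₖ tensorPow n ω = (V ⊗ₖ tensorPow n W) *
      diagonal (fun a => ((p a.1 * ∏ t, q (a.2 t) : ℝ) : ℂ)) * (V ⊗ₖ tensorPow n W)ᴴ := by
    rw [hp, hωn, kronecker_conj]
    simp only [Complex.ofReal_mul]
  obtain ⟨T, hT, hTout⟩ := exists_isThermalOperation_of_perm (β := β)
    (kronecker_mem_unitaryGroup hV hWn) (kronecker_mem_unitaryGroup hV' hWn) hH hH' hd F π hπ
  have hP1 : ∑ a : S × (Fin n → C), p a.1 * ∏ t, q (a.2 t) = 1 := by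
    simp only [Fintype.sum_prod_type]
    rw [← Finset.sum_mul_sum, hp1, sum_prod_eq_one q hq1, one_mul]
  have hP0 : ∀ a : S × (Fin n → C), 0 ≤ p a.1 * ∏ t, q (a.2 t) := fun a =>
    mul_nonneg (hp0 _) (Finset.prod_nonneg fun t _ => hq0 _)
  let out : S × (Fin n → C) → ℝ := fun a' => ∑ a, (p a.1 * ∏ t, q (a.2 t)) *
    ∑ b, Real.exp (-(β * F b)) / (∑ b', Real.exp (-(β * F b'))) *
      (if (π (a, b)).1 = a' then 1 else 0)
  have hout1 : ∑ a', out a' = 1 := sum_channel_eq_one hd F (fun a b => (π (a, b)).1) _ hP1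
  have houtG : ∀ a', (∑ a, (p a.1 * ∏ t, q (a.2 t)) * G a a') - ε ≤ out a' := by
    intro a'
    have h1 : (∑ a, (p a.1 * ∏ t, q (a.2 t)) * G a a') - ε =
        ∑ a : S × (Fin n → C), (p a.1 * ∏ t, q (a.2 t)) * (G a a' - ε) := by
      simp only [mul_sub, Finset.sum_sub_distrib, ← Finset.sum_mul, hP1, one_mul]
    rw [h1]
    exact Finset.sum_le_sum fun a _ => mul_le_mul_of_nonneg_left (hTG a a') (hP0 a)
  have hTρ : T (ρ ⊗ₖ tensorPow n ω) = (V' ⊗ₖ tensorPow n W) *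
      diagonal (fun a => (out a : ℂ)) * (V' ⊗ₖ tensorPow n W)ᴴ := by
    rw [hin]; exact hTout _
  have hεn : (Fintype.card S : ℝ) * Fintype.card (Fin n → C) * ε = 1 / n := by
    simp only [ε]; field_simp
  refine ⟨T, hT, ?_, ?_⟩
  · rw [hTρ, traceFst_conj_diagonal _ hV', hωn]
    simp only [← Complex.ofReal_sum]
    refine (traceDist_conj_diagonal_le hWn _ _ ?_).trans ?_
    · rw [← Fintype.sum_prod_type_right, hout1, sum_prod_eq_one q hq1]
    · refine (sum_max_sub_sum_le _ _ _ ε hε.le fun y s' => houtG (s', y)).trans ?_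
      rw [mul_comm (Fintype.card (Fin n → C) : ℝ), hεn, add_div]
      refine add_le_add hGC ?_
      refine one_div_le_one_div_of_le hsn0 (Real.sqrt_le_left hn0.le |>.2 ?_)
      have : (1 : ℝ) ≤ n := by exact_mod_cast hn
      nlinarith
  · rw [hTρ, traceSnd_conj_diagonal _ hWn, hs]
    simp only [← Complex.ofReal_sum]
    refine (traceDist_conj_diagonal_le hV' _ _ ?_).trans ?_
    · rw [← Fintype.sum_prod_type, hout1, hs1]
    · refine (sum_max_sub_sum_le _ _ _ ε hε.le fun s' y => houtG (s', y)).trans ?_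
      rw [hεn, add_div]
      exact add_le_add hGS le_rfl
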